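/- Let $V$ (items), $\mathcal A$ (annotators) and $E$ (comparisons) be finite sets; each $e\in E$ is made by an annotator $\alpha(e)\in\mathcal A$ who compares a left item $i(e)\in V$ with a right item $j(e)\in V$. Let $(\delta_0\theta)(e)=\theta_{i(e)}-\theta_{j(e)}$ and $(A\gamma)(e)=\gamma_{\alpha(e)}$, and consider the linear model $$Y=\delta_0\theta+A\gamma+\varepsilon,\qquad \theta\in\mathbb R^V,\ \gamma\in\mathbb R^{\mathcal A},\quad \varepsilon_e \text{ i.i.d. } N(0,\sigma^2),\quad |E|\ge 2|\mathcal A|+|V|.$$ Let $\tilde A\in\mathbb R^{E\times\mathcal A}$ and $s\in\mathbb R^{\mathcal A}$ be any (deterministic) knockoff matrix and vector with $$\tilde A^T\tilde A=A^TA,\qquad A^T\tilde A=A^TA-\mathrm{diag}(s),\qquad \delta_0^T\tilde A=\delta_0^TA,$$ and put $A_{ko}=[A,\tilde A]$. For $y\in\mathbb R^E$ consider one of the following solution paths: * LASSO: for $\lambda>0$, $(\hat\theta,\hat\gamma)(\lambda)$ minimizes $\frac12\|y-\delta_0\theta-A_{ko}\gamma\|_2^2+\lambda\|\gamma\|_1$;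 * ISS: $p(0)=0$, $\frac{dp}{dt}=A_{ko}^T(y-\delta_0\hat\theta-A_{ko}\hat\gamma)$, $0=\delta_0^T(y-\delta_0\hat\theta-A_{ko}\hat\gamma)$ and $p\in\partial\|\hat\gamma\|_1$ for all $t\ge0$, where $p$ is continuous, $\hat\gamma$ is a right-continuous step function with finitely many jumps and $dp/dt$ is the right derivative; * LBI, with parameters $\kappa,\Delta t>0$ and a time horizon $T\le\infty$: $w^0=0$, $\gamma^0=0$, $\theta^0=(\delta_0^T\delta_0)^\dagger\delta_0^Ty$ and, with $r^k=y-\delta_0\theta^k-A_{ko}\gamma^k$, $w^{k+1}=w^k+\Delta t\,A_{ko}^Tr^k$, $\gamma^{k+1}=\kappa\,\mathrm{shrink}(w^{k+1})$, $\theta^{k+1}=\theta^k+\kappa\Delta t\,\delta_0^Tr^k$, where $\mathrm{shrink}(x)=\mathrm{sign}(x)\max(|x|-1,0)$ acts coordinatewise; iterate $k$ has time $k\Delta t$, and the iteration stops as soon as $k\Delta t>T$. Let $Z_j$ and $\tilde Z_j$ be the entry times of the $j$-th columns of $A$ and $\tilde A$ on the chosen path for $y=Y$, that is, the supremum of the $\lambda>0$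 (LASSO), or of the $1/t$ with $t>0$ (ISS/LBI), at which the coefficient of that column is nonzero, and $0$ if there is none; where the solution is not unique, "nonzero" means nonzero in at least one solution. Let $W_j=\max(Z_j,\tilde Z_j)\,\mathrm{sign}(Z_j-\tilde Z_j)$, and for $q\in[0,1]$ and $c\in\{0,1\}$ let $$T_c=\min\Big\{t\in\{|W_i|:W_i\neq0\}:\ \frac{c+\#\{j:W_j\le -t\}}{\#\{j:W_j\ge t\}\vee1}\le q\Big\}\quad(\min\emptyset=\infty),\qquad \hat S_c=\{j:W_j\ge T_c\}.$$ Then, for every $q\in[0,1]$, the knockoff filter $\hat S_0$ satisfies $$\mathbb E\left[\frac{\#\{j:\gamma_j=0,\ j\in\hat S_0\}}{\#\hat S_0+q^{-1}}\right]\le q$$ (with $q^{-1}=\infty$ for $q=0$), and the knockoff+ filter $\hat S_1$ satisfies $$\mathbb E\left[\frac{\#\{j:\gamma_j=0,\ j\in\hat S_1\}}{\#\hat S_1\vee1}\right]\le q .$$ In particular both random variables are measurable (up to null sets). -/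

import Mathlib

open MeasureTheory ProbabilityTheory Matrix
open scoped NNReal ENNReal

namespace CrowdKnockoff

noncomputable section

/-! Design matrices of the model. A comparison `e : E` is made by the annotator `annot e` and shows
the candidate `left e` on the left and the candidate `right e` on the right. -/

/-- The gradient operator `(δ₀ θ)(e) = θ (left e) - θ (right e)`, as a matrix. -/
def gradientMatrix {E V : Type*} [DecidableEq V] (left right : E → V) : Matrix E V ℝ :=
  Matrix.of fun e v => (if left e = v then 1 else 0) - (if right e = v then 1 else 0)

/-- The annotator operator `(A γ)(e) = γ (annot e)`, as a matrix. -/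
def annotatorMatrix {E U : Type*} [DecidableEq U] (annot : E → U) : Matrix E U ℝ :=
  Matrix.of fun e u => if annot e = u then 1 else 0

/-- `B` is a knockoff copy of the features `A` (relative to the unpenalized features `D`), with
parameter vector `s`. -/
structure IsKnockoff {E U V : Type*} [Fintype E] [DecidableEq U]
    (D : Matrix E V ℝ) (A B : Matrix E U ℝ) (s : U → ℝ) : Prop where
  gram : Bᵀ * B = Aᵀ * A
  cross : Aᵀ * B = Aᵀ * A - Matrix.diagonal s
  grad : Dᵀ * B = Dᵀ * A

/-! Solution paths for the response `Y`, the unpenalized design `D` and the penalized design `X`. -/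

section Paths

variable {E V J : Type*} [Fintype E] [Fintype V] [Fintype J]

/-- The residual `Y - D θ - X γ`. -/
def fitResidual (D : Matrix E V ℝ) (X : Matrix E J ℝ) (Y : E → ℝ) (θ : V → ℝ) (γ : J → ℝ) : E → ℝ :=
  Y - D *ᵥ θ - X *ᵥ γ

/-- The `ℓ¹` norm. -/
def l1Norm (γ : J → ℝ) : ℝ := ∑ j, |γ j|

/-- `½ ‖Y - D θ - X γ‖₂² + lam ‖γ‖₁`. -/
def lassoObjective (D : Matrix E V ℝ) (X : Matrix E J ℝ) (Y : E → ℝ) (lam : ℝ)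
    (θ : V → ℝ) (γ : J → ℝ) : ℝ :=
  1 / 2 * ∑ e, fitResidual D X Y θ γ e ^ 2 + lam * l1Norm γ

/-- `(θ, γ)` minimizes the LASSO objective with penalty `lam`. -/
def IsLassoSolution (D : Matrix E V ℝ) (X : Matrix E J ℝ) (Y : E → ℝ) (lam : ℝ)
    (θ : V → ℝ) (γ : J → ℝ) : Prop :=
  ∀ (θ' : V → ℝ) (γ' : J → ℝ), lassoObjective D X Y lam θ γ ≤ lassoObjective D X Y lam θ' γ'

/-- Entry time of the feature `j` on the LASSO path: the supremum of the penalties `lam > 0` at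
which `γ_j ≠ 0` (and `0` if there is none). The solution need not be unique; `γ_j ≠ 0` is then read
as: some solution has a nonzero `j`-th coefficient. -/
def lassoEntry (D : Matrix E V ℝ) (X : Matrix E J ℝ) (Y : E → ℝ) (j : J) : ℝ :=
  sSup {lam : ℝ | 0 < lam ∧ ∃ θ γ, IsLassoSolution D X Y lam θ γ ∧ γ j ≠ 0}

/-- `p ∈ ∂‖γ‖₁`. -/
def IsL1Subgradient (p γ : J → ℝ) : Prop :=
  ∀ x : J → ℝ, l1Norm γ + p ⬝ᵥ (x - γ) ≤ l1Norm x

/-- `(p, θ, γ)` solves the Inverse Scale Space dynamics on `[0, ∞)`, started at `p(0) = 0`, in the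
usual regularity class of these dynamics: `p` is continuous, `γ` is a right-continuous step function
with finitely many jumps (at the times in `F`), and, since `p` has kinks at the jumps of `γ`, `dp/dt`
is the right derivative, at every time. -/
structure IsISSPath (D : Matrix E V ℝ) (X : Matrix E J ℝ) (Y : E → ℝ)
    (p : ℝ → J → ℝ) (θ : ℝ → V → ℝ) (γ : ℝ → J → ℝ) : Prop where
  init : p 0 = 0
  cont : ContinuousOn p (Set.Ici 0)
  flow : ∀ t, 0 ≤ t → HasDerivWithinAt p (Xᵀ *ᵥ fitResidual D X Y (θ t) (γ t)) (Set.Ici t) t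
  normal : ∀ t, 0 ≤ t → Dᵀ *ᵥ fitResidual D X Y (θ t) (γ t) = 0
  subgrad : ∀ t, 0 ≤ t → IsL1Subgradient (p t) (γ t)
  steps : ∃ F : Finset ℝ, ∀ a b, 0 ≤ a → a ≤ b → (∀ x ∈ F, ¬ (a < x ∧ x ≤ b)) → γ a = γ b

/-- Entry time of the feature `j` on the ISS path: the supremum of `1 / t` over the times `t > 0`
with `γ_j(t) ≠ 0` (for some solution path, if there are several), and `0` if there is none. -/
def issEntry (D : Matrix E V ℝ) (X : Matrix E J ℝ) (Y : E → ℝ) (j : J) : ℝ :=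
  sSup {r : ℝ | ∃ t, 0 < t ∧ (∃ p θ γ, IsISSPath D X Y p θ γ ∧ γ t j ≠ 0) ∧ r = 1 / t}

/-- The Moore-Penrose inverse of a real symmetric matrix, through its spectral decomposition:
nonzero eigenvalues are inverted, zero eigenvalues are kept (`0⁻¹ = 0`). -/
def symmPinv [DecidableEq V] (M : Matrix V V ℝ) (hM : M.IsHermitian) : Matrix V V ℝ :=
  (hM.eigenvectorUnitary : Matrix V V ℝ) * Matrix.diagonal (fun i => (hM.eigenvalues i)⁻¹) *
    (hM.eigenvectorUnitary : Matrix V V ℝ)ᴴ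

/-- `shrink x = sign(x) max(|x| - 1, 0)`. -/
def shrink (x : ℝ) : ℝ := Real.sign x * max (|x| - 1) 0

/-- The variables of the Linearized Bregman Iteration. -/
structure LBIState (V J : Type*) where
  w : J → ℝ
  γ : J → ℝ
  θ : V → ℝ

/-- The iterates of the Linearized Bregman Iteration with damping `κ` and step size `dt`. -/
def lbiState [DecidableEq V] (D : Matrix E V ℝ) (X : Matrix E J ℝ) (Y : E → ℝ) (κ dt : ℝ) :
    ℕ → LBIState V J
  | 0 =>
    { w := 0
      γ := 0
      θ := symmPinv (Dᵀ * D) (by simpa using Matrix.isHermitian_conjTranspose_mul_self D) *ᵥ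
        (Dᵀ *ᵥ Y) }
  | k + 1 =>
    let S := lbiState D X Y κ dt k
    let r := fitResidual D X Y S.θ S.γ
    let w' := S.w + dt • (Xᵀ *ᵥ r)
    { w := w'
      γ := fun j => κ * shrink (w' j)
      θ := S.θ + (κ * dt) • (Dᵀ *ᵥ r) }

/-- Entry time of the feature `j` on the LBI path, the `k`-th iterate having time `k * dt`. The
iteration is left as soon as `k * dt` exceeds the horizon `T` (`T = ⊤`: never). -/
def lbiEntry [DecidableEq V] (D : Matrix E V ℝ) (X : Matrix E J ℝ) (Y : E → ℝ) (κ dt : ℝ)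
    (T : EReal) (j : J) : ℝ :=
  sSup {r : ℝ | ∃ k : ℕ, 0 < k ∧ (∀ i < k, (((i : ℝ) * dt : ℝ) : EReal) ≤ T) ∧
    (lbiState D X Y κ dt k).γ j ≠ 0 ∧ r = 1 / ((k : ℝ) * dt)}

end Paths

/-- The procedures that produce a solution path. -/
inductive PathMethod : Type
  | lasso : PathMethod
  | iss : PathMethod
  | lbi (κ dt : ℝ) (hκ : 0 < κ) (hdt : 0 < dt) (T : EReal) : PathMethod

/-- The entry time of the feature `j` on the path of the given procedure. -/
def PathMethod.entry {E V J : Type*} [Fintype E] [Fintype V] [Fintype J] [DecidableEq V]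
    (m : PathMethod) (D : Matrix E V ℝ) (X : Matrix E J ℝ) (Y : E → ℝ) (j : J) : ℝ :=
  match m with
  | .lasso => lassoEntry D X Y j
  | .iss => issEntry D X Y j
  | .lbi κ dt _ _ T => lbiEntry D X Y κ dt T j

/-- The statistics `W_j = max(Z_j, Z'_j) sign(Z_j - Z'_j)`, where `Z_j` and `Z'_j` are the entry
times of the `j`-th column of `A` and of its knockoff, for the extended design `[A, B]`. -/
def knockoffStat {E U V : Type*} [Fintype E] [Fintype U] [Fintype V] [DecidableEq V]
    (m : PathMethod) (D : Matrix E V ℝ) (A B : Matrix E U ℝ) (Y : E → ℝ) (j : U) : ℝ :=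
  let Z := m.entry D (Matrix.fromCols A B) Y (Sum.inl j)
  let Z' := m.entry D (Matrix.fromCols A B) Y (Sum.inr j)
  max Z Z' * Real.sign (Z - Z')

/-- The cut `T_c`: the least `t` among the nonzero values `|W_j|` with
`(c + #{j : W_j ≤ -t}) / (#{j : W_j ≥ t} ∨ 1) ≤ q`, and `∞` if there is none. The knockoff filter
has `c = 0`, the knockoff+ filter `c = 1`. -/
def knockoffCut {U : Type*} [Fintype U] (c q : ℝ) (W : U → ℝ) : EReal :=
  sInf {x : EReal | ∃ t : ℝ, x = (t : EReal) ∧ (∃ i, W i ≠ 0 ∧ t = |W i|) ∧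
    (c + ((Finset.univ.filter fun j => W j ≤ -t).card : ℝ)) /
      max ((Finset.univ.filter fun j => t ≤ W j).card : ℝ) 1 ≤ q}

open Classical in
/-- The selected set `{j : W_j ≥ T_c}`. -/
def selected {U : Type*} [Fintype U] (c q : ℝ) (W : U → ℝ) : Finset U :=
  Finset.univ.filter fun j => knockoffCut c q W ≤ (W j : EReal)

open Classical in
/-- The number of false discoveries `#{j : γ_j = 0 and j ∈ S}`. -/
def falseDiscoveries {U : Type*} (γ : U → ℝ) (S : Finset U) : ℕ :=
  (S.filter fun j => γ j = 0).card

/-- The modified false discovery proportion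
`#{j : γ_j = 0 and j ∈ S} / (#S + q⁻¹)`, with `q⁻¹ = ∞` for `q = 0`. -/
def modifiedFDP {U : Type*} (q : ℝ) (γ : U → ℝ) (S : Finset U) : ℝ≥0∞ :=
  (falseDiscoveries γ S : ℝ≥0∞) / ((S.card : ℝ≥0∞) + (ENNReal.ofReal q)⁻¹)

/-- The false discovery proportion `#{j : γ_j = 0 and j ∈ S} / (#S ∨ 1)`. -/
def FDP {U : Type*} (γ : U → ℝ) (S : Finset U) : ℝ≥0∞ :=
  (falseDiscoveries γ S : ℝ≥0∞) / max (S.card : ℝ≥0∞) 1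

end

end CrowdKnockoff

/-! Only one property of the statistic `W` matters: for every null `j`, its law is invariant under
changing the sign of `W j`.

Sign symmetry. The knockoff identities make the reflection orthogonal to the difference of column
`j` and its knockoff exchange these two columns and fix all other columns of the design
(`IsKnockoff.isSymmetry`). Each path depends on the design and the response in an orthogonally
equivariant way, so reflecting the response permutes the entry times (`IsSymmetry.entry`), that is,
flips the sign of `W j`. For a null `j` the mean of the response is fixed by the reflection, and the
noise is rotation invariant (`map_mulVec_pi_gaussianReal`).

Leave-one-out bound. With `T` the cut, both proportions are at most `q` times the sum over nulls `j`
of `1{W j ≥ T} / (1 + #{null k : W k ≤ -T})`. In the `j`-th term `T` may be replaced by `cutAbs`,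
which does not see the sign of `W j`. Flipping that sign preserves the expectation of the term, and
the sum of the flipped terms is pointwise at most 1, because all contributing `j` share one cut
(`cutAbs_le_cutAbs`).

Measurability. The LASSO and ISS entry times quantify over all solutions. Projections of σ-compact
sets are σ-compact, hence Borel; for ISS the paths are first reduced to finitely many affine pieces
(`exists_issPath_iff`). -/

namespace CrowdKnockoff

/-! ### The data-dependent cut and the leave-one-out bound. -/

section Cut

variable {U : Type*} [Fintype U]

/-- The candidate cuts: the nonzero values `|w i|` at which the estimated proportion is at most
`q`. -/
def IsFeasibleCut (c q : ℝ) (w : U → ℝ) (t : ℝ) : Prop :=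
  (∃ i, w i ≠ 0 ∧ t = |w i|) ∧
    (c + ((Finset.univ.filter fun j => w j ≤ -t).card : ℝ)) /
      max ((Finset.univ.filter fun j => t ≤ w j).card : ℝ) 1 ≤ q

lemma IsFeasibleCut.pos {c q : ℝ} {w : U → ℝ} {t : ℝ} (h : IsFeasibleCut c q w t) : 0 < t := by
  obtain ⟨⟨i, hi, rfl⟩, -⟩ := h
  exact abs_pos.2 hi

lemma knockoffCut_le {c q : ℝ} {w : U → ℝ} {t : ℝ} (h : IsFeasibleCut c q w t) :
    knockoffCut c q w ≤ (t : EReal) :=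
  sInf_le ⟨t, rfl, h⟩

/-- The candidates are among the finitely many `|w i|`, so a nonempty infimum is attained. -/
lemma knockoffCut_eq_top_or (c q : ℝ) (w : U → ℝ) :
    knockoffCut c q w = ⊤ ∨ ∃ t : ℝ, knockoffCut c q w = (t : EReal) ∧ IsFeasibleCut c q w t := by
  set s : Set EReal := {x : EReal | ∃ t : ℝ, x = (t : EReal) ∧ IsFeasibleCut c q w t} with hs
  have hcut : knockoffCut c q w = sInf s := rfl
  have hfin : s.Finite := by
    refine (Set.finite_range fun i => ((|w i| : ℝ) : EReal)).subset ?_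
    rintro x ⟨t, rfl, ⟨i, -, rfl⟩, -⟩
    exact ⟨i, rfl⟩
  rcases s.eq_empty_or_nonempty with h | h
  · left
    rw [hcut, h, sInf_empty]
  · right
    obtain ⟨t, ht, hf⟩ := h.csInf_mem hfin
    exact ⟨t, hcut.trans ht, hf⟩

lemma knockoffCut_pos (c q : ℝ) (w : U → ℝ) : 0 < knockoffCut c q w := by
  rcases knockoffCut_eq_top_or c q w with h | ⟨t, h, hf⟩
  · rw [h]; exact EReal.zero_lt_top
  · rw [h]; exact_mod_cast hf.pos

omit [Fintype U] in
lemma measurable_abs_eval (i : U) : Measurable fun w : U → ℝ => |w i| :=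
  continuous_abs.measurable.comp (measurable_pi_apply i)

lemma measurable_knockoffCut (c q : ℝ) :
    Measurable fun w : U → ℝ => knockoffCut c q w := by
  classical
  have hcount : ∀ (p : U → (U → ℝ) → Prop), (∀ j, MeasurableSet {w | p j w}) →
      Measurable fun w : U → ℝ => ((Finset.univ.filter fun j => p j w).card : ℝ) := by
    intro p hp
    simp only [Finset.card_filter, Nat.cast_sum, Nat.cast_ite, Nat.cast_one, Nat.cast_zero]
    exact Finset.measurable_sum _ fun j _ => Measurable.ite (hp j) measurable_const measurable_const
  have hfeas : ∀ i, MeasurableSet {w : U → ℝ | w i ≠ 0 ∧ IsFeasibleCut c q w |w i|} := by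
    intro i
    have h0 : MeasurableSet {w : U → ℝ | w i ≠ 0} :=
      (measurableSet_eq_fun (measurable_pi_apply i) measurable_const).compl
    have h1 : MeasurableSet {w : U → ℝ |
        (c + ((Finset.univ.filter fun j => w j ≤ -|w i|).card : ℝ)) /
          max ((Finset.univ.filter fun j => |w i| ≤ w j).card : ℝ) 1 ≤ q} := by
      refine measurableSet_le (Measurable.div (measurable_const.add (hcount _ fun j => ?_))
        ((hcount _ fun j => ?_).max measurable_const)) measurable_const
      · exact measurableSet_le (measurable_pi_apply j)
          (measurable_abs_eval i).neg
      · exact measurableSet_le (measurable_abs_eval i) (measurable_pi_apply j)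
    convert h0.inter h1 using 1
    ext w
    constructor
    · rintro ⟨h, -, h'⟩; exact ⟨h, h'⟩
    · rintro ⟨h, h'⟩; exact ⟨h, ⟨i, h, rfl⟩, h'⟩
  have hcut : (fun w : U → ℝ => knockoffCut c q w) = fun w => ⨅ i,
      if w i ≠ 0 ∧ IsFeasibleCut c q w |w i| then ((|w i| : ℝ) : EReal) else ⊤ := by
    funext w
    apply le_antisymm
    · refine le_iInf fun i => ?_
      split_ifs with h
      · exact knockoffCut_le h.2
      · exact le_top
    · refine le_sInf ?_
      rintro x ⟨t, rfl, ⟨i, hi, rfl⟩, h⟩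
      refine (iInf_le _ i).trans ?_
      rw [if_pos ⟨hi, ⟨i, hi, rfl⟩, h⟩]
  rw [hcut]
  refine Measurable.iInf fun i => Measurable.ite (hfeas i) ?_ measurable_const
  exact measurable_coe_real_ereal.comp (measurable_abs_eval i)

lemma measurableSet_selected_eq (c q : ℝ) (S : Finset U) :
    MeasurableSet {w : U → ℝ | selected c q w = S} := by
  have : {w : U → ℝ | selected c q w = S} =
      ⋂ j, {w | knockoffCut c q w ≤ (w j : EReal) ↔ j ∈ S} := by
    ext w
    simp [Finset.ext_iff, selected]
  rw [this]
  refine MeasurableSet.iInter fun j => ?_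
  have h : MeasurableSet {w : U → ℝ | knockoffCut c q w ≤ (w j : EReal)} :=
    measurableSet_le (measurable_knockoffCut c q)
      (measurable_coe_real_ereal.comp (measurable_pi_apply j))
  by_cases hj : j ∈ S
  · simpa only [hj, iff_true] using h
  · simp only [hj, iff_false]
    exact h.compl

lemma measurable_comp_selected (c q : ℝ) (f : Finset U → ℝ≥0∞) :
    Measurable fun w : U → ℝ => f (selected c q w) := by
  classical
  let _ : MeasurableSpace (Finset U) := ⊤
  have h : Measurable fun w : U → ℝ => selected c q w :=
    measurable_to_countable' fun S => measurableSet_selected_eq c q S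
  exact (measurable_from_top (f := f)).comp h

variable [DecidableEq U]

/-- The cut computed after replacing `w j` by `|w j|`. -/
noncomputable def cutAbs (c q : ℝ) (w : U → ℝ) (j : U) : EReal :=
  knockoffCut c q (Function.update w j |w j|)

/-- Change of the sign of the `j`-th coordinate. -/
def flipSign (j : U) (w : U → ℝ) : U → ℝ := Function.update w j (-w j)

lemma cutAbs_flipSign (c q : ℝ) (w : U → ℝ) (j : U) :
    cutAbs c q (flipSign j w) j = cutAbs c q w j := by
  simp [cutAbs, flipSign]

omit [Fintype U] in
lemma measurable_flipSign (j : U) : Measurable (flipSign j : (U → ℝ) → U → ℝ) := by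
  refine measurable_pi_lambda _ fun k => ?_
  by_cases h : k = j
  · subst h; simpa [flipSign] using measurable_pi_apply (X := fun _ => ℝ) k
  · simpa [flipSign, h] using measurable_pi_apply k

lemma measurable_cutAbs (c q : ℝ) (j : U) : Measurable fun w : U → ℝ => cutAbs c q w j := by
  refine (measurable_knockoffCut c q).comp (measurable_pi_lambda _ fun k => ?_)
  by_cases h : k = j
  · subst h; simpa using measurable_abs_eval k
  · simpa [h] using measurable_pi_apply k

lemma card_le_neg_update_abs {w : U → ℝ} {t : ℝ} (ht : 0 < t) {j : U} (hj : w j ≤ -t) :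
    (Finset.univ.filter fun k => Function.update w j |w j| k ≤ -t).card =
      (Finset.univ.filter fun k => w k ≤ -t).card - 1 := by
  rw [← Finset.card_erase_of_mem (a := j) (by simpa using hj)]
  congr 1
  ext k
  by_cases h : k = j
  · subst h
    simpa using (by linarith [abs_nonneg (w k)] : -t < |w k|)
  · simp [h]

lemma card_le_update_abs {w : U → ℝ} {t : ℝ} (ht : 0 < t) {j : U} (hj : w j ≤ -t) :
    (Finset.univ.filter fun k => t ≤ Function.update w j |w j| k).card =
      (Finset.univ.filter fun k => t ≤ w k).card + 1 := by
  rw [← Finset.card_insert_of_notMem (a := j)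
    (s := Finset.univ.filter fun k => t ≤ w k) (by simp; linarith)]
  congr 1
  ext k
  by_cases h : k = j
  · subst h
    simpa using (by rw [abs_of_nonpos (by linarith)]; linarith : t ≤ |w k|)
  · simp [h]

/-- Making one coordinate below `-t` positive lowers the negative count by one and raises the
positive count by one, whichever coordinate it is; the absolute values stay the same. So feasibility
of `t` passes from `j` to `k`. -/
lemma cutAbs_le_of_isFeasibleCut {c q : ℝ} {w : U → ℝ} {t : ℝ} {j k : U} (hj : w j ≤ -t)
    (hk : w k ≤ -t) (h : IsFeasibleCut c q (Function.update w j |w j|) t) :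
    cutAbs c q w k ≤ (t : EReal) := by
  have ht := h.pos
  refine knockoffCut_le ⟨?_, ?_⟩
  · obtain ⟨⟨i, hi, hti⟩, -⟩ := h
    have habs : ∀ l, |Function.update w l |w l| i| = |w i| := by
      intro l
      by_cases hl : i = l
      · subst hl; simp
      · simp [hl]
    have h0 : w i ≠ 0 := by
      rw [habs] at hti
      exact abs_pos.1 (hti ▸ ht)
    refine ⟨i, ?_, by rw [hti, habs, habs]⟩
    rw [← abs_pos, habs]
    exact abs_pos.2 h0
  · have := h.2
    rw [card_le_neg_update_abs ht hj, card_le_update_abs ht hj] at this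
    rwa [card_le_neg_update_abs ht hk, card_le_update_abs ht hk]

/-- If the cut `t` of `k` were strictly smaller than that of `j`, both coordinates would lie below
`-t`, and `t` would be feasible for `j` too. By symmetry, all such coordinates have equal cuts. -/
lemma cutAbs_le_cutAbs {c q : ℝ} {w : U → ℝ} {j k : U}
    (hj : cutAbs c q w j ≤ ((-w j : ℝ) : EReal)) (hk : cutAbs c q w k ≤ ((-w k : ℝ) : EReal)) :
    cutAbs c q w j ≤ cutAbs c q w k := by
  by_contra hlt
  rw [not_le] at hlt
  rcases knockoffCut_eq_top_or c q (Function.update w k |w k|) with h | ⟨t, h, hf⟩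
  · change cutAbs c q w k = ⊤ at h
    exact absurd (hk.trans_lt (EReal.coe_lt_top _)) (by simp [h])
  · change cutAbs c q w k = t at h
    rw [h] at hk hlt
    have hk' : t ≤ -w k := by exact_mod_cast hk
    have hj' : t ≤ -w j := by exact_mod_cast hlt.le.trans hj
    exact absurd (cutAbs_le_of_isFeasibleCut (by linarith) (by linarith) hf) (not_le.2 hlt)

lemma cutAbs_eq_of_knockoffCut_le {c q : ℝ} {w : U → ℝ} {j : U}
    (h : knockoffCut c q w ≤ (w j : EReal)) : cutAbs c q w j = knockoffCut c q w := by
  have h0 : 0 < w j := by exact_mod_cast (knockoffCut_pos c q w).trans_le h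
  rw [cutAbs, abs_of_pos h0, Function.update_eq_self]

open Classical in
/-- The contribution of the null `j` to the leave-one-out bound. -/
noncomputable def looTerm (c q : ℝ) (N : Finset U) (j : U) (w : U → ℝ) : ℝ≥0∞ :=
  if cutAbs c q w j ≤ (w j : EReal) then
    ((1 : ℝ≥0∞) + (((N.erase j).filter fun k =>
      cutAbs c q w j ≤ ((-w k : ℝ) : EReal)).card : ℝ≥0∞))⁻¹
  else 0

lemma measurable_looTerm (c q : ℝ) (N : Finset U) (j : U) : Measurable (looTerm c q N j) := by
  classical
  refine Measurable.ite (measurableSet_le (measurable_cutAbs c q j)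
    (measurable_coe_real_ereal.comp (measurable_pi_apply j))) ?_ measurable_const
  refine Measurable.inv (Measurable.const_add ?_ _)
  simp only [Finset.card_filter, Nat.cast_sum, Nat.cast_ite, Nat.cast_one, Nat.cast_zero]
  exact Finset.measurable_sum _ fun k _ => Measurable.ite
    (measurableSet_le (measurable_cutAbs c q j)
      (measurable_coe_real_ereal.comp (measurable_pi_apply k).neg)) measurable_const measurable_const

open Classical in
lemma looTerm_flipSign (c q : ℝ) (N : Finset U) (j : U) (w : U → ℝ) :
    looTerm c q N j (flipSign j w) = if cutAbs c q w j ≤ ((-w j : ℝ) : EReal) then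
      ((1 : ℝ≥0∞) + (((N.erase j).filter fun k =>
        cutAbs c q w j ≤ ((-w k : ℝ) : EReal)).card : ℝ≥0∞))⁻¹ else 0 := by
  have h : ((N.erase j).filter fun k => cutAbs c q w j ≤ ((-flipSign j w k : ℝ) : EReal)) =
      (N.erase j).filter fun k => cutAbs c q w j ≤ ((-w k : ℝ) : EReal) := by
    refine Finset.filter_congr fun k hk => ?_
    rw [flipSign, Function.update_of_ne (Finset.ne_of_mem_erase hk)]
  rw [looTerm, cutAbs_flipSign, h, flipSign, Function.update_self]

/-- Only the nulls in `act` contribute. The cut of each is at most that of every other, so each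
denominator counts all of `act`: there are `act.card` terms, each at most `1 / act.card`. -/
lemma sum_looTerm_flipSign_le_one (c q : ℝ) (N : Finset U) (w : U → ℝ) :
    ∑ j ∈ N, looTerm c q N j (flipSign j w) ≤ 1 := by
  classical
  set act : Finset U := N.filter fun j => cutAbs c q w j ≤ ((-w j : ℝ) : EReal) with hact
  simp_rw [looTerm_flipSign]
  rw [← Finset.sum_filter]
  have hterm : ∀ j ∈ act, ((1 : ℝ≥0∞) + (((N.erase j).filter fun k =>
      cutAbs c q w j ≤ ((-w k : ℝ) : EReal)).card : ℝ≥0∞))⁻¹ ≤ (act.card : ℝ≥0∞)⁻¹ := by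
    intro j hj
    rw [ENNReal.inv_le_inv]
    have hle : act.card ≤ 1 + ((N.erase j).filter fun k =>
        cutAbs c q w j ≤ ((-w k : ℝ) : EReal)).card := by
      rw [add_comm, ← Finset.card_erase_add_one hj]
      refine Nat.add_le_add_right (Finset.card_le_card fun k hk => ?_) 1
      obtain ⟨hkj, hk⟩ := Finset.mem_erase.1 hk
      obtain ⟨hkN, hk'⟩ := Finset.mem_filter.1 hk
      exact Finset.mem_filter.2 ⟨Finset.mem_erase.2 ⟨hkj, hkN⟩,
        (cutAbs_le_cutAbs (Finset.mem_filter.1 hj).2 hk').trans hk'⟩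
    exact_mod_cast hle
  refine (Finset.sum_le_sum hterm).trans ?_
  rw [Finset.sum_const, nsmul_eq_mul]
  exact ENNReal.mul_inv_le_one _

-- A selected coordinate is positive, so its leave-one-out cut is the actual cut. Erasing `j` from
-- the denominator only enlarges the term.
open Classical in
lemma card_mul_inv_le_sum_looTerm (c q : ℝ) (N : Finset U) (w : U → ℝ) :
    ((N.filter fun j => knockoffCut c q w ≤ (w j : EReal)).card : ℝ≥0∞) *
      ((1 : ℝ≥0∞) + ((N.filter fun k =>
        knockoffCut c q w ≤ ((-w k : ℝ) : EReal)).card : ℝ≥0∞))⁻¹ ≤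
      ∑ j ∈ N, looTerm c q N j w := by
  refine le_trans ?_ (Finset.sum_le_sum_of_subset (Finset.filter_subset
    (fun j => knockoffCut c q w ≤ (w j : EReal)) N))
  rw [← nsmul_eq_mul, ← Finset.sum_const]
  refine Finset.sum_le_sum fun j hj => ?_
  have h := (Finset.mem_filter.1 hj).2
  rw [looTerm, cutAbs_eq_of_knockoffCut_le h, if_pos h, ENNReal.inv_le_inv]
  gcongr
  exact Finset.erase_subset _ _

/-- Each summand is flipped in its own coordinate, so invariance under single sign changes suffices.
-/
lemma lintegral_sum_looTerm_le {ν : Measure (U → ℝ)} [IsProbabilityMeasure ν] (c q : ℝ)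
    (N : Finset U) (hν : ∀ j ∈ N, ν.map (flipSign j) = ν) :
    ∫⁻ w, ∑ j ∈ N, looTerm c q N j w ∂ν ≤ 1 := by
  calc ∫⁻ w, ∑ j ∈ N, looTerm c q N j w ∂ν
      = ∑ j ∈ N, ∫⁻ w, looTerm c q N j w ∂ν :=
        lintegral_finsetSum _ fun j _ => measurable_looTerm c q N j
    _ = ∑ j ∈ N, ∫⁻ w, looTerm c q N j (flipSign j w) ∂ν := by
        refine Finset.sum_congr rfl fun j hj => ?_
        conv_lhs => rw [← hν j hj]
        exact lintegral_map (measurable_looTerm c q N j) (measurable_flipSign j)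
    _ = ∫⁻ w, ∑ j ∈ N, looTerm c q N j (flipSign j w) ∂ν :=
        (lintegral_finsetSum _ fun j _ =>
          (measurable_looTerm c q N j).comp (measurable_flipSign j)).symm
    _ ≤ ∫⁻ _, 1 ∂ν := lintegral_mono fun w => sum_looTerm_flipSign_le_one c q N w
    _ = 1 := by simp

end Cut

/-! ### From sign symmetry to control of the false discovery rate. -/

section FDR

variable {U : Type*} [Fintype U]

open Classical in
lemma falseDiscoveries_selected (c q : ℝ) (γ w : U → ℝ) :
    falseDiscoveries γ (selected c q w) = ((Finset.univ.filter fun j => γ j = 0).filter fun j =>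
      knockoffCut c q w ≤ (w j : EReal)).card := by
  rw [falseDiscoveries, selected, Finset.filter_comm]

open Classical in
/-- At the cut, the estimated number of false discoveries is controlled by the number of
selections. -/
lemma card_neg_le_of_selected {c q : ℝ} (γ : U → ℝ) {w : U → ℝ}
    (h : (selected c q w).Nonempty) :
    c + (((Finset.univ.filter fun j => γ j = 0).filter fun k =>
      knockoffCut c q w ≤ ((-w k : ℝ) : EReal)).card : ℝ) ≤ q * (selected c q w).card := by
  rcases knockoffCut_eq_top_or c q w with hT | ⟨t, hT, hf⟩
  · obtain ⟨j, hj⟩ := h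
    simp [selected, hT] at hj
  · have hsel : selected c q w = Finset.univ.filter fun j => t ≤ w j := by
      ext j; simp [selected, hT]
    have h1 : (1 : ℝ) ≤ (selected c q w).card := by exact_mod_cast h.card_pos
    have h2 := hf.2
    rw [← hsel, max_eq_left h1, div_le_iff₀ (by linarith)] at h2
    refine le_trans ?_ h2
    gcongr
    intro k hk
    have := (Finset.mem_filter.1 hk).2
    rw [hT] at this
    have : t ≤ -w k := by exact_mod_cast this
    simp; linarith

lemma ennreal_div_le_ofReal_mul {v n : ℕ} {q x : ℝ} (hq : 0 ≤ q) (hx : 0 < x)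
    (h : 1 + (n : ℝ) ≤ q * x) :
    (v : ℝ≥0∞) / ENNReal.ofReal x ≤ ENNReal.ofReal q * ((v : ℝ≥0∞) * (1 + (n : ℝ≥0∞))⁻¹) := by
  have h1 : (1 + (n : ℝ≥0∞)) = ENNReal.ofReal (1 + n) := by
    rw [ENNReal.ofReal_add zero_le_one n.cast_nonneg]; simp
  have h2 : (v : ℝ≥0∞) = ENNReal.ofReal v := by simp
  have hn : (0 : ℝ) < 1 + n := by positivity
  rw [h1, h2, ← ENNReal.ofReal_div_of_pos hx, ← ENNReal.ofReal_inv_of_pos hn,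
    ← ENNReal.ofReal_mul v.cast_nonneg, ← ENNReal.ofReal_mul hq]
  apply ENNReal.ofReal_le_ofReal
  rw [div_le_iff₀ hx, ← div_eq_mul_inv, mul_div_assoc', div_mul_eq_mul_div, le_div_iff₀ hn]
  nlinarith [mul_le_mul_of_nonneg_left h (v.cast_nonneg : (0 : ℝ) ≤ v)]

lemma FDP_le_sum_looTerm [DecidableEq U] {q : ℝ} (hq : 0 ≤ q) (γ w : U → ℝ) :
    FDP γ (selected 1 q w) ≤ ENNReal.ofReal q *
      ∑ j ∈ Finset.univ.filter (fun j => γ j = 0),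
        looTerm 1 q (Finset.univ.filter fun j => γ j = 0) j w := by
  classical
  rcases (selected 1 q w).eq_empty_or_nonempty with h | h
  · simp [FDP, falseDiscoveries, h]
  · refine le_trans ?_ (mul_le_mul_right (card_mul_inv_le_sum_looTerm 1 q _ w) _)
    have h1 : 1 ≤ (selected 1 q w).card := h.card_pos
    have h2 : max ((selected 1 q w).card : ℝ≥0∞) 1 = ENNReal.ofReal (selected 1 q w).card := by
      rw [max_eq_left (by exact_mod_cast h1)]; simp
    rw [FDP, h2, falseDiscoveries_selected]
    exact ennreal_div_le_ofReal_mul hq (by exact_mod_cast h1) (card_neg_le_of_selected γ h)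

/-- The summand `q⁻¹` in the denominator replaces the offset `c = 1` of knockoff+: `q * (#S + q⁻¹) =
q * #S + 1`. For `q = 0` the denominator is infinite. -/
lemma modifiedFDP_le_sum_looTerm [DecidableEq U] {q : ℝ} (hq : 0 ≤ q) (γ w : U → ℝ) :
    modifiedFDP q γ (selected 0 q w) ≤ ENNReal.ofReal q *
      ∑ j ∈ Finset.univ.filter (fun j => γ j = 0),
        looTerm 0 q (Finset.univ.filter fun j => γ j = 0) j w := by
  classical
  rcases hq.eq_or_lt with rfl | hq
  · simp [modifiedFDP]
  rcases (selected 0 q w).eq_empty_or_nonempty with h | h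
  · simp [modifiedFDP, falseDiscoveries, h]
  · refine le_trans ?_ (mul_le_mul_right (card_mul_inv_le_sum_looTerm 0 q _ w) _)
    have h1 := card_neg_le_of_selected γ h
    have h2 : ((selected 0 q w).card : ℝ≥0∞) + (ENNReal.ofReal q)⁻¹ =
        ENNReal.ofReal ((selected 0 q w).card + q⁻¹) := by
      rw [ENNReal.ofReal_add (Nat.cast_nonneg _) (inv_nonneg.2 hq.le),
        ENNReal.ofReal_inv_of_pos hq]
      simp
    rw [modifiedFDP, h2, falseDiscoveries_selected]
    refine ennreal_div_le_ofReal_mul hq.le (by positivity) ?_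
    rw [mul_add, mul_inv_cancel₀ hq.ne']
    linarith

/-- FDR control of the knockoff filters for statistics whose law is invariant under sign changes of
the null coordinates. -/
theorem lintegral_modifiedFDP_le {ν : Measure (U → ℝ)} [IsProbabilityMeasure ν] [DecidableEq U]
    {q : ℝ} (hq : 0 ≤ q) (γ : U → ℝ) (hν : ∀ j, γ j = 0 → ν.map (flipSign j) = ν) :
    ∫⁻ w, modifiedFDP q γ (selected 0 q w) ∂ν ≤ ENNReal.ofReal q := by
  refine (lintegral_mono fun w => modifiedFDP_le_sum_looTerm hq γ w).trans ?_
  rw [lintegral_const_mul _ (Finset.measurable_sum _ fun j _ => measurable_looTerm _ _ _ j)]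
  exact mul_le_of_le_one_right' (lintegral_sum_looTerm_le _ _ _ fun j hj => hν j (by simpa using hj))

theorem lintegral_FDP_le {ν : Measure (U → ℝ)} [IsProbabilityMeasure ν] [DecidableEq U]
    {q : ℝ} (hq : 0 ≤ q) (γ : U → ℝ) (hν : ∀ j, γ j = 0 → ν.map (flipSign j) = ν) :
    ∫⁻ w, FDP γ (selected 1 q w) ∂ν ≤ ENNReal.ofReal q := by
  refine (lintegral_mono fun w => FDP_le_sum_looTerm hq γ w).trans ?_
  rw [lintegral_const_mul _ (Finset.measurable_sum _ fun j _ => measurable_looTerm _ _ _ j)]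
  exact mul_le_of_le_one_right' (lintegral_sum_looTerm_le _ _ _ fun j hj => hν j (by simpa using hj))

end FDR

/-! ### Equivariance of the paths under orthogonal symmetries of the design. -/

section Symmetry

set_option linter.unusedSectionVars false

variable {E V J : Type*} [Fintype E] [Fintype V] [Fintype J] [DecidableEq E]

/-- `R` is an orthogonal involution that fixes the columns of `D` and permutes those of `X` by
the involution `π`. -/
structure IsSymmetry (D : Matrix E V ℝ) (X : Matrix E J ℝ) (R : Matrix E E ℝ)
    (π : Equiv.Perm J) : Prop where
  symm : Rᵀ = R
  mul_self : R * R = 1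
  fix : R * D = D
  perm : R * X = X.submatrix id π
  invol : ∀ j, π (π j) = j

variable {D : Matrix E V ℝ} {X : Matrix E J ℝ} {R : Matrix E E ℝ} {π : Equiv.Perm J}

namespace IsSymmetry

lemma mulVec_submatrix (γ : J → ℝ) : X.submatrix id π *ᵥ γ = X *ᵥ (γ ∘ π.symm) := by
  ext e
  simp only [mulVec, dotProduct, submatrix_apply, id, Function.comp]
  exact Fintype.sum_equiv π _ _ fun j => by simp

lemma perm_symm (h : IsSymmetry D X R π) : π.symm = π := by
  ext j
  rw [Equiv.symm_apply_eq, h.invol]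

lemma comp_comp (h : IsSymmetry D X R π) (γ : J → ℝ) : (γ ∘ π) ∘ π = γ := by
  ext j; simp [h.invol]

lemma mulVec_mulVec (h : IsSymmetry D X R π) (y : E → ℝ) : R *ᵥ (R *ᵥ y) = y := by
  rw [Matrix.mulVec_mulVec, h.mul_self, one_mulVec]

/-- `R` can be pulled out because it fixes `D *ᵥ θ` and maps `X *ᵥ (γ ∘ π)` to `X *ᵥ γ`. The
equivariance of all three paths rests on this identity. -/
lemma fitResidual (h : IsSymmetry D X R π) (y : E → ℝ) (θ : V → ℝ) (γ : J → ℝ) :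
    fitResidual D X (R *ᵥ y) θ γ = R *ᵥ fitResidual D X y θ (γ ∘ π) := by
  have h1 : R *ᵥ (D *ᵥ θ) = D *ᵥ θ := by rw [Matrix.mulVec_mulVec, h.fix]
  have h2 : R *ᵥ (X *ᵥ (γ ∘ π)) = X *ᵥ γ := by
    rw [Matrix.mulVec_mulVec, h.perm, mulVec_submatrix, h.perm_symm, h.comp_comp]
  rw [CrowdKnockoff.fitResidual, CrowdKnockoff.fitResidual, mulVec_sub, mulVec_sub, h1, h2]

lemma transpose_mulVec_left (h : IsSymmetry D X R π) (r : E → ℝ) : Dᵀ *ᵥ (R *ᵥ r) = Dᵀ *ᵥ r := by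
  rw [Matrix.mulVec_mulVec, ← h.symm, ← transpose_mul, h.fix]

lemma transpose_mulVec_right (h : IsSymmetry D X R π) (r : E → ℝ) :
    Xᵀ *ᵥ (R *ᵥ r) = (Xᵀ *ᵥ r) ∘ π := by
  rw [Matrix.mulVec_mulVec, ← h.symm, ← transpose_mul, h.perm]
  rfl

lemma sum_sq (h : IsSymmetry D X R π) (r : E → ℝ) : ∑ e, (R *ᵥ r) e ^ 2 = ∑ e, r e ^ 2 := by
  have : (R *ᵥ r) ⬝ᵥ (R *ᵥ r) = r ⬝ᵥ r := by
    rw [dotProduct_mulVec, vecMul_mulVec, h.symm, h.mul_self, vecMul_one]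
  simpa [dotProduct, sq] using this

end IsSymmetry

lemma l1Norm_comp_perm (π : Equiv.Perm J) (γ : J → ℝ) : l1Norm (γ ∘ π) = l1Norm γ :=
  Equiv.sum_comp π fun j => |γ j|

lemma IsL1Subgradient.comp_perm {p γ : J → ℝ} (h : IsL1Subgradient p γ) (π : Equiv.Perm J) :
    IsL1Subgradient (p ∘ π) (γ ∘ π) := by
  intro x
  have := h (x ∘ π.symm)
  rw [l1Norm_comp_perm] at this
  rw [l1Norm_comp_perm]
  convert this using 2
  exact Fintype.sum_equiv π _ _ fun j => by simp

namespace IsSymmetry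

lemma lassoObjective (h : IsSymmetry D X R π) (y : E → ℝ) (lam : ℝ) (θ : V → ℝ) (γ : J → ℝ) :
    lassoObjective D X (R *ᵥ y) lam θ γ = lassoObjective D X y lam θ (γ ∘ π) := by
  rw [CrowdKnockoff.lassoObjective, CrowdKnockoff.lassoObjective, h.fitResidual, h.sum_sq,
    l1Norm_comp_perm]

lemma isLassoSolution (h : IsSymmetry D X R π) {y : E → ℝ} {lam : ℝ} {θ : V → ℝ} {γ : J → ℝ}
    (hs : IsLassoSolution D X y lam θ γ) : IsLassoSolution D X (R *ᵥ y) lam θ (γ ∘ π) := by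
  intro θ' γ'
  rw [h.lassoObjective, h.lassoObjective, h.comp_comp]
  exact hs _ _

lemma isISSPath (h : IsSymmetry D X R π) {y : E → ℝ} {p : ℝ → J → ℝ} {θ : ℝ → V → ℝ}
    {γ : ℝ → J → ℝ} (hs : IsISSPath D X y p θ γ) :
    IsISSPath D X (R *ᵥ y) (fun t => p t ∘ π) θ (fun t => γ t ∘ π) where
  init := by rw [hs.init]; rfl
  cont := by
    refine continuousOn_pi.2 fun j => ?_
    exact (continuous_apply (π j)).comp_continuousOn hs.cont
  flow := fun t ht => by
    rw [h.fitResidual, h.comp_comp, h.transpose_mulVec_right, hasDerivWithinAt_pi]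
    exact fun j => hasDerivWithinAt_pi.1 (hs.flow t ht) (π j)
  normal := fun t ht => by
    rw [h.fitResidual, h.comp_comp, h.transpose_mulVec_left, hs.normal t ht]
  subgrad := fun t ht => (hs.subgrad t ht).comp_perm π
  steps := by
    obtain ⟨F, hF⟩ := hs.steps
    exact ⟨F, fun a b ha hab hx => by rw [hF a b ha hab hx]⟩

/-- The start depends on the response only through `Dᵀ *ᵥ y`, which `R` preserves, and the shrinkage
acts coordinatewise. -/
lemma lbiState [DecidableEq V] (h : IsSymmetry D X R π) (y : E → ℝ) (κ dt : ℝ) (k : ℕ) :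
    (lbiState D X (R *ᵥ y) κ dt k).w = (lbiState D X y κ dt k).w ∘ π ∧
    (lbiState D X (R *ᵥ y) κ dt k).γ = (lbiState D X y κ dt k).γ ∘ π ∧
    (lbiState D X (R *ᵥ y) κ dt k).θ = (lbiState D X y κ dt k).θ := by
  induction k with
  | zero =>
    refine ⟨rfl, rfl, ?_⟩
    simp only [CrowdKnockoff.lbiState]
    rw [h.transpose_mulVec_left]
  | succ k ih =>
    obtain ⟨hw, hγ, hθ⟩ := ih
    simp only [CrowdKnockoff.lbiState]
    rw [hw, hγ, hθ, h.fitResidual, h.comp_comp, h.transpose_mulVec_left, h.transpose_mulVec_right]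
    exact ⟨rfl, rfl, rfl⟩

lemma lassoEntry (h : IsSymmetry D X R π) (y : E → ℝ) (j : J) :
    lassoEntry D X (R *ᵥ y) j = lassoEntry D X y (π j) := by
  rw [CrowdKnockoff.lassoEntry, CrowdKnockoff.lassoEntry]
  congr 1
  ext lam
  refine and_congr_right fun _ => ⟨?_, ?_⟩
  · rintro ⟨θ, γ, hs, hj⟩
    -- Since `R` is an involution, the converse is the same transport applied to the response `R *ᵥ
    -- y`.
    have := h.isLassoSolution hs
    rw [h.mulVec_mulVec] at this
    exact ⟨θ, γ ∘ π, this, by simpa [h.invol] using hj⟩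
  · rintro ⟨θ, γ, hs, hj⟩
    exact ⟨θ, γ ∘ π, h.isLassoSolution hs, hj⟩

lemma issEntry (h : IsSymmetry D X R π) (y : E → ℝ) (j : J) :
    issEntry D X (R *ᵥ y) j = issEntry D X y (π j) := by
  rw [CrowdKnockoff.issEntry, CrowdKnockoff.issEntry]
  congr 1
  ext r
  refine exists_congr fun t => and_congr_right fun _ => and_congr_left fun _ => ⟨?_, ?_⟩
  · rintro ⟨p, θ, γ, hs, hj⟩
    have := h.isISSPath hs
    rw [h.mulVec_mulVec] at this
    exact ⟨_, _, _, this, by simpa [h.invol] using hj⟩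
  · rintro ⟨p, θ, γ, hs, hj⟩
    exact ⟨_, _, _, h.isISSPath hs, hj⟩

lemma lbiEntry [DecidableEq V] (h : IsSymmetry D X R π) (y : E → ℝ) (κ dt : ℝ) (T : EReal)
    (j : J) : lbiEntry D X (R *ᵥ y) κ dt T j = lbiEntry D X y κ dt T (π j) := by
  simp only [CrowdKnockoff.lbiEntry, (h.lbiState y κ dt _).2.1, Function.comp]

lemma entry [DecidableEq V] (h : IsSymmetry D X R π) (m : PathMethod) (y : E → ℝ) (j : J) :
    m.entry D X (R *ᵥ y) j = m.entry D X y (π j) := by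
  cases m with
  | lasso => exact h.lassoEntry y j
  | iss => exact h.issEntry y j
  | lbi κ dt _ _ T => exact h.lbiEntry y κ dt T j

end IsSymmetry

/-- The matrix of the reflection in the hyperplane orthogonal to `v`. -/
noncomputable def reflectionMatrix (v : E → ℝ) : Matrix E E ℝ := 1 - (2 / (v ⬝ᵥ v)) • vecMulVec v v

lemma reflectionMatrix_transpose (v : E → ℝ) : (reflectionMatrix v)ᵀ = reflectionMatrix v := by
  simp [reflectionMatrix, transpose_vecMulVec]

lemma reflectionMatrix_mul_apply {I : Type*} (v : E → ℝ) (M : Matrix E I ℝ) (e : E) (i : I) :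
    (reflectionMatrix v * M) e i = M e i - 2 / (v ⬝ᵥ v) * (v e * (v ⬝ᵥ fun e' => M e' i)) := by
  rw [reflectionMatrix, Matrix.sub_mul, Matrix.one_mul, smul_mul, vecMulVec_mul]
  simp [vecMulVec_apply, vecMul]

lemma reflectionMatrix_mul_self (v : E → ℝ) : reflectionMatrix v * reflectionMatrix v = 1 := by
  rcases eq_or_ne (v ⬝ᵥ v) 0 with h | h
  -- Here `2 / 0 = 0`, so the matrix is the identity.
  · simp [reflectionMatrix, h]
  · have : vecMulVec v v * vecMulVec v v = (v ⬝ᵥ v) • vecMulVec v v := by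
      rw [vecMulVec_mul_vecMulVec]
      ext; simp [vecMulVec_apply]; ring
    have hc : ∀ c : ℝ, c * (v ⬝ᵥ v) = 2 →
        (1 - c • vecMulVec v v) * (1 - c • vecMulVec v v) = 1 := by
      intro c hc
      rw [sub_mul, mul_sub, one_mul, mul_sub, mul_one, one_mul, smul_mul_smul_comm, this,
        smul_smul, mul_assoc, hc]
      module
    exact hc _ (div_mul_cancel₀ 2 h)

end Symmetry

/-! ### The reflection that swaps a feature with its knockoff. -/

section Swap

variable {E U V : Type*} [Fintype E] [Fintype U] [Fintype V] [DecidableEq E] [DecidableEq U]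
  {D : Matrix E V ℝ} {A B : Matrix E U ℝ} {s : U → ℝ}

/-- The reflection that exchanges a column with its knockoff. -/
noncomputable def swapReflection (A B : Matrix E U ℝ) (j : U) : Matrix E E ℝ :=
  reflectionMatrix fun e => A e j - B e j

-- With `v` the difference of the two columns, the knockoff identities give `v ⊥ D`, inner products
-- `s j` and `-s j` with columns `j` of `A` and `B` and `0` with the others, and `v ⬝ᵥ v = 2 * s j`.
-- The reflection therefore subtracts `v` from the column of `A`, adds it to that of `B`, and fixes
-- the rest.
omit [Fintype U] [Fintype V] in
lemma IsKnockoff.isSymmetry (h : IsKnockoff D A B s) (j : U) :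
    IsSymmetry D (fromCols A B) (swapReflection A B j) (Equiv.swap (Sum.inl j) (Sum.inr j)) := by
  set v : E → ℝ := fun e => A e j - B e j with hv
  have hsub : ∀ x : E → ℝ, v ⬝ᵥ x = (∑ e, A e j * x e) - ∑ e, B e j * x e := by
    intro x; simp [hv, dotProduct, sub_mul]
  have gram : ∀ i k, ∑ e, B e i * B e k = ∑ e, A e i * A e k := fun i k => by
    simpa [mul_apply] using congrFun (congrFun h.gram i) k
  have cross : ∀ i k, ∑ e, A e i * B e k = (∑ e, A e i * A e k) - diagonal s i k := fun i k => by
    simpa [mul_apply] using congrFun (congrFun h.cross i) k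
  have cross' : ∀ i k, ∑ e, B e i * A e k = (∑ e, A e i * A e k) - diagonal s i k := fun i k => by
    have := cross k i
    simp only [mul_comm (A _ k)] at this
    rw [this]
    by_cases hik : i = k
    · subst hik; rfl
    · simp [diagonal_apply_ne _ hik, diagonal_apply_ne _ (Ne.symm hik)]
  have grad : ∀ i k, ∑ e, B e i * D e k = ∑ e, A e i * D e k := fun i k => by
    simpa [mul_apply, mul_comm] using congrFun (congrFun h.grad k) i
  have hA : ∀ k, v ⬝ᵥ (fun e => A e k) = diagonal s j k := fun k => by
    rw [hsub, cross']; ring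
  have hB : ∀ k, v ⬝ᵥ (fun e => B e k) = -diagonal s j k := fun k => by
    rw [hsub, cross, gram]; ring
  have hvv : v ⬝ᵥ v = 2 * s j := by
    have : v ⬝ᵥ v = v ⬝ᵥ (fun e => A e j) - v ⬝ᵥ fun e => B e j := by
      rw [← dotProduct_sub]; rfl
    rw [this, hA, hB, diagonal_apply_eq]; ring
  -- If `s j = 0` then `v = 0`: the feature equals its knockoff and both sides vanish.
  have hv0 : ∀ e, 2 / (v ⬝ᵥ v) * (v e * s j) = v e := fun e => by
    rcases eq_or_ne (s j) 0 with h0 | h0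
    · have : v = 0 := dotProduct_self_eq_zero.1 (by rw [hvv, h0, mul_zero])
      simp [this]
    · rw [hvv]; field_simp
  refine ⟨reflectionMatrix_transpose v, reflectionMatrix_mul_self v, ?_, ?_,
    fun i => Equiv.swap_apply_self _ _ i⟩
  · ext e i
    have h0 : (v ⬝ᵥ fun e' => D e' i) = 0 := by rw [hsub, grad, sub_self]
    rw [swapReflection, reflectionMatrix_mul_apply, h0, mul_zero, mul_zero, sub_zero]
  · ext e i
    rw [swapReflection, reflectionMatrix_mul_apply, submatrix_apply, id]
    rcases i with i | i
    · rw [show (fun e' => fromCols A B e' (Sum.inl i)) = fun e' => A e' i from rfl, hA]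
      by_cases hij : i = j
      · subst hij
        rw [Equiv.swap_apply_left, diagonal_apply_eq, hv0]
        simp [hv]
      · rw [Equiv.swap_apply_of_ne_of_ne (by simpa using hij) (by simp),
          diagonal_apply_ne _ (Ne.symm hij)]
        simp
    · rw [show (fun e' => fromCols A B e' (Sum.inr i)) = fun e' => B e' i from rfl, hB]
      by_cases hij : i = j
      · subst hij
        rw [Equiv.swap_apply_right, diagonal_apply_eq, mul_neg, mul_neg, hv0]
        simp [hv]
      · rw [Equiv.swap_apply_of_ne_of_ne (by simp) (by simpa using hij),
          diagonal_apply_ne _ (Ne.symm hij)]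
        simp

/-- For a null `j` the mean response does not involve column `j`, and the reflection fixes all
columns that it does involve. -/
lemma IsKnockoff.swapReflection_mulVec (h : IsKnockoff D A B s) (j : U) {γ : U → ℝ}
    (hj : γ j = 0) (θ : V → ℝ) :
    swapReflection A B j *ᵥ (D *ᵥ θ + A *ᵥ γ) = D *ᵥ θ + A *ᵥ γ := by
  have hA : A *ᵥ γ = fromCols A B *ᵥ Sum.elim γ 0 := by simp [fromCols_mulVec]
  have hsym := h.isSymmetry j
  rw [mulVec_add, Matrix.mulVec_mulVec, hsym.fix, hA, Matrix.mulVec_mulVec, hsym.perm,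
    IsSymmetry.mulVec_submatrix, hsym.perm_symm]
  congr 2
  ext i
  rcases i with i | i
  · by_cases hij : i = j
    · subst hij; simp [hj]
    · simp [Equiv.swap_apply_of_ne_of_ne, hij]
  · by_cases hij : i = j
    · subst hij; simp [hj]
    · simp [Equiv.swap_apply_of_ne_of_ne, hij]

lemma IsKnockoff.knockoffStat_swapReflection [DecidableEq V] (h : IsKnockoff D A B s)
    (m : PathMethod) (j : U) (y : E → ℝ) :
    knockoffStat m D A B (swapReflection A B j *ᵥ y) = flipSign j (knockoffStat m D A B y) := by
  have hsym := h.isSymmetry j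
  ext i
  simp only [knockoffStat, flipSign, hsym.entry]
  by_cases hij : i = j
  · subst hij
    rw [Equiv.swap_apply_left, Equiv.swap_apply_right, Function.update_self, max_comm, ← neg_sub,
      Real.sign_neg, mul_neg]
  · rw [Equiv.swap_apply_of_ne_of_ne (by simpa using hij) (by simp),
      Equiv.swap_apply_of_ne_of_ne (by simp) (by simpa using hij), Function.update_of_ne hij]
    rfl

end Swap

/-! ### σ-compact sets and measurability of suprema. -/

section SigmaCompact

variable {X Y : Type*} [TopologicalSpace X] [TopologicalSpace Y]

lemma isSigmaCompact_of_isClosed [SigmaCompactSpace X] {s : Set X} (hs : IsClosed s) :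
    IsSigmaCompact s :=
  isSigmaCompact_univ.of_isClosed_subset hs (Set.subset_univ s)

lemma isSigmaCompact_inter [T2Space X] {s t : Set X} (hs : IsSigmaCompact s)
    (ht : IsSigmaCompact t) : IsSigmaCompact (s ∩ t) := by
  obtain ⟨K, hK, rfl⟩ := hs
  obtain ⟨L, hL, rfl⟩ := ht
  rw [Set.iUnion_inter_iUnion]
  exact isSigmaCompact_iUnion _ fun i => isSigmaCompact_iUnion _ fun j =>
    ((hK _).inter (hL _)).isSigmaCompact

lemma isSigmaCompact_union {s t : Set X} (hs : IsSigmaCompact s) (ht : IsSigmaCompact t) :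
    IsSigmaCompact (s ∪ t) := by
  rw [Set.union_eq_iUnion]
  exact isSigmaCompact_iUnion _ fun b => by cases b <;> assumption

lemma isSigmaCompact_preimage [T2Space Y] [SigmaCompactSpace X] {f : X → Y} (hf : Continuous f)
    {s : Set Y} (hs : IsSigmaCompact s) : IsSigmaCompact (f ⁻¹' s) := by
  obtain ⟨K, hK, rfl⟩ := hs
  rw [Set.preimage_iUnion]
  exact isSigmaCompact_iUnion _ fun i => isSigmaCompact_of_isClosed ((hK i).isClosed.preimage hf)

lemma isSigmaCompact_of_isOpen {X : Type*} [PseudoEMetricSpace X] [SigmaCompactSpace X]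
    {s : Set X} (hs : IsOpen s) : IsSigmaCompact s := by
  obtain ⟨F, hF, -, rfl, -⟩ := hs.exists_iUnion_isClosed
  exact isSigmaCompact_iUnion _ fun n => isSigmaCompact_of_isClosed (hF n)

/-- This handles the quantifier over solutions: a projection of a general Borel set need not be
Borel, but a continuous image of a σ-compact set is σ-compact. -/
lemma isSigmaCompact_exists {s : Set (X × Y)} (hs : IsSigmaCompact s) :
    IsSigmaCompact {x | ∃ y, (x, y) ∈ s} := by
  convert hs.image continuous_fst using 1
  ext x
  simp

lemma measurableSet_of_isSigmaCompact [T2Space X] [MeasurableSpace X] [BorelSpace X] {s : Set X}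
    (hs : IsSigmaCompact s) : MeasurableSet s := by
  obtain ⟨K, hK, rfl⟩ := hs
  exact MeasurableSet.iUnion fun n => (hK n).measurableSet

end SigmaCompact

lemma measurable_sSup_setOf {X : Type*} [MeasurableSpace X] {p : X → ℝ → Prop}
    (hpos : ∀ x r, p x r → 0 < r) (hp : ∀ a, MeasurableSet {x | ∃ r, a < r ∧ p x r}) :
    Measurable fun x => sSup {r | p x r} := by
  refine measurable_of_Ioi fun a => ?_
  have h0 : ∀ x, 0 ≤ sSup {r | p x r} := fun x => Real.sSup_nonneg fun r hr => (hpos x r hr).le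
  rcases lt_or_ge a 0 with ha | ha
  · convert MeasurableSet.univ
    exact Set.eq_univ_of_forall fun x => ha.trans_le (h0 x)
  -- The real `sSup` is `0` on empty and on unbounded sets, so for `a ≥ 0` exceeding `a` means
  -- having an element above `a` and some natural number as an upper bound.
  · have : (fun x => sSup {r | p x r}) ⁻¹' Set.Ioi a =
        {x | ∃ r, a < r ∧ p x r} ∩ ⋃ n : ℕ, {x | ∃ r, (n : ℝ) < r ∧ p x r}ᶜ := by
      ext x
      simp only [Set.mem_preimage, Set.mem_Ioi, Set.mem_inter_iff, Set.mem_ofPred_eq,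
        Set.mem_iUnion, Set.mem_compl_iff]
      constructor
      · intro hx
        have hb : BddAbove {r | p x r} := by
          by_contra hb
          rw [Real.sSup_of_not_bddAbove hb] at hx
          linarith
        have hne : {r | p x r}.Nonempty := by
          by_contra hne
          rw [Set.not_nonempty_iff_eq_empty.1 hne, Real.sSup_empty] at hx
          linarith
        obtain ⟨r, hr, har⟩ := exists_lt_of_lt_csSup hne hx
        obtain ⟨b, hb⟩ := hb
        obtain ⟨n, hn⟩ := exists_nat_ge b
        refine ⟨⟨r, har, hr⟩, n, ?_⟩
        rintro ⟨r', hr', hp'⟩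
        exact absurd (hb hp') (not_le.2 (hn.trans_lt hr'))
      · rintro ⟨⟨r, har, hr⟩, n, hn⟩
        push Not at hn
        exact har.trans_le (le_csSup ⟨n, fun r' hr' => by
          by_contra hlt
          exact hn r' (not_le.1 hlt) hr'⟩ hr)
    rw [this]
    exact (hp a).inter (MeasurableSet.iUnion fun n => (hp n).compl)

lemma measurable_sign : Measurable Real.sign := by
  unfold Real.sign
  exact Measurable.ite measurableSet_Iio measurable_const
    (Measurable.ite measurableSet_Ioi measurable_const measurable_const)

/-! ### Measurability of the LASSO and LBI entry times; encoding of ISS paths. -/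

section Paths

variable {E V J : Type*} [Fintype E] [Fintype V] [Fintype J]

omit [Fintype E] in
lemma continuous_fitResidual (D : Matrix E V ℝ) (X : Matrix E J ℝ) :
    Continuous fun z : (E → ℝ) × (V → ℝ) × (J → ℝ) => fitResidual D X z.1 z.2.1 z.2.2 := by
  unfold fitResidual
  fun_prop

lemma continuous_l1Norm : Continuous (l1Norm : (J → ℝ) → ℝ) := by
  unfold l1Norm
  fun_prop

lemma continuous_lassoObjective (D : Matrix E V ℝ) (X : Matrix E J ℝ) {Z : Type*}
    [TopologicalSpace Z] {y : Z → E → ℝ} {lam : Z → ℝ} {θ : Z → V → ℝ} {γ : Z → J → ℝ}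
    (hy : Continuous y) (hlam : Continuous lam) (hθ : Continuous θ) (hγ : Continuous γ) :
    Continuous fun z => lassoObjective D X (y z) (lam z) (θ z) (γ z) := by
  have h1 : Continuous fun z => l1Norm (γ z) := continuous_l1Norm.comp hγ
  have h2 : Continuous fun z => fitResidual D X (y z) (θ z) (γ z) :=
    (continuous_fitResidual D X).comp (hy.prodMk (hθ.prodMk hγ))
  unfold lassoObjective
  fun_prop

lemma measurable_lassoEntry (D : Matrix E V ℝ) (X : Matrix E J ℝ) (j : J) :
    Measurable fun y => lassoEntry D X y j := by
  refine measurable_sSup_setOf (fun _ _ h => h.1) fun a => ?_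
  set C : Set ((E → ℝ) × ℝ × (V → ℝ) × (J → ℝ)) :=
    {z | IsLassoSolution D X z.1 z.2.1 z.2.2.1 z.2.2.2}
  set O : Set ((E → ℝ) × ℝ × (V → ℝ) × (J → ℝ)) :=
    {z | a < z.2.1 ∧ 0 < z.2.1 ∧ z.2.2.2 j ≠ 0}
  have hC : IsClosed C := by
    have h2 : C = ⋂ (θ' : V → ℝ) (γ' : J → ℝ), {z | lassoObjective D X z.1 z.2.1 z.2.2.1 z.2.2.2 ≤
        lassoObjective D X z.1 z.2.1 θ' γ'} := by
      ext z
      simp only [Set.mem_iInter]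
      rfl
    rw [h2]
    exact isClosed_iInter fun θ' => isClosed_iInter fun γ' =>
      isClosed_le (continuous_lassoObjective D X continuous_fst continuous_snd.fst
        continuous_snd.snd.fst continuous_snd.snd.snd) (continuous_lassoObjective D X continuous_fst
        continuous_snd.fst continuous_const continuous_const)
  have hO : IsOpen O := by
    have h1 : IsOpen {z : (E → ℝ) × ℝ × (V → ℝ) × (J → ℝ) | a < z.2.1} :=
      isOpen_lt (by fun_prop) (by fun_prop)
    have h2 : IsOpen {z : (E → ℝ) × ℝ × (V → ℝ) × (J → ℝ) | 0 < z.2.1} :=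
      isOpen_lt (by fun_prop) (by fun_prop)
    have h3 : IsOpen {z : (E → ℝ) × ℝ × (V → ℝ) × (J → ℝ) | z.2.2.2 j ≠ 0} :=
      isOpen_ne_fun (by fun_prop) (by fun_prop)
    exact h1.inter (h2.inter h3)
  have h := measurableSet_of_isSigmaCompact (isSigmaCompact_exists
    (isSigmaCompact_inter (isSigmaCompact_of_isClosed hC) (isSigmaCompact_of_isOpen hO)))
  convert h using 1
  ext y
  constructor
  · rintro ⟨lam, ha, h0, θ, γ, hs, hj⟩
    exact ⟨(lam, θ, γ), hs, ha, h0, hj⟩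
  · rintro ⟨⟨lam, θ, γ⟩, hs, ha, h0, hj⟩
    exact ⟨lam, ha, h0, θ, γ, hs, hj⟩

lemma measurable_shrink : Measurable shrink := by
  unfold shrink
  exact measurable_sign.mul (by fun_prop)

lemma measurable_mulVec {I K : Type*} [Fintype K] [Countable I] (M : Matrix I K ℝ) :
    Measurable fun x : K → ℝ => M *ᵥ x :=
  (by fun_prop : Continuous fun x : K → ℝ => M *ᵥ x).measurable

lemma measurable_lbiState [DecidableEq V] (D : Matrix E V ℝ) (X : Matrix E J ℝ) (κ dt : ℝ)
    (k : ℕ) : Measurable (fun y => (lbiState D X y κ dt k).w) ∧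
      Measurable (fun y => (lbiState D X y κ dt k).γ) ∧
      Measurable (fun y => (lbiState D X y κ dt k).θ) := by
  induction k with
  | zero =>
    refine ⟨measurable_const, measurable_const, ?_⟩
    exact (measurable_mulVec _).comp (measurable_mulVec _)
  | succ k ih =>
    obtain ⟨hw, hγ, hθ⟩ := ih
    have hr : Measurable fun y => fitResidual D X y (lbiState D X y κ dt k).θ
        (lbiState D X y κ dt k).γ :=
      (continuous_fitResidual D X).measurable.comp (measurable_id.prodMk (hθ.prodMk hγ))
    have hX : Measurable fun y => Xᵀ *ᵥ fitResidual D X y (lbiState D X y κ dt k).θ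
        (lbiState D X y κ dt k).γ := (measurable_mulVec Xᵀ).comp hr
    have hD : Measurable fun y => Dᵀ *ᵥ fitResidual D X y (lbiState D X y κ dt k).θ
        (lbiState D X y κ dt k).γ := (measurable_mulVec Dᵀ).comp hr
    have hw' : Measurable fun y => (lbiState D X y κ dt (k + 1)).w :=
      hw.add (hX.const_smul dt)
    refine ⟨hw', ?_, hθ.add (hD.const_smul (κ * dt))⟩
    exact measurable_pi_lambda _ fun j =>
      (measurable_shrink.comp ((measurable_pi_apply j).comp hw')).const_mul κ

lemma measurable_lbiEntry [DecidableEq V] (D : Matrix E V ℝ) (X : Matrix E J ℝ) {κ dt : ℝ}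
    (hdt : 0 < dt) (T : EReal) (j : J) : Measurable fun y => lbiEntry D X y κ dt T j := by
  refine measurable_sSup_setOf ?_ fun a => ?_
  · rintro y r ⟨k, hk, -, -, rfl⟩
    positivity
  · have : {y | ∃ r, a < r ∧ ∃ k : ℕ, 0 < k ∧ (∀ i < k, (((i : ℝ) * dt : ℝ) : EReal) ≤ T) ∧
        (lbiState D X y κ dt k).γ j ≠ 0 ∧ r = 1 / ((k : ℝ) * dt)} =
        ⋃ k : ℕ, {y | (lbiState D X y κ dt k).γ j ≠ 0} ∩
          {_y | a < 1 / ((k : ℝ) * dt) ∧ 0 < k ∧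
            ∀ i < k, (((i : ℝ) * dt : ℝ) : EReal) ≤ T} := by
      ext y
      simp only [Set.mem_ofPred_eq, Set.mem_iUnion, Set.mem_inter_iff]
      constructor
      · rintro ⟨r, har, k, hk, hT, hj, rfl⟩
        exact ⟨k, hj, har, hk, hT⟩
      · rintro ⟨k, hj, har, hk, hT⟩
        exact ⟨_, har, k, hk, hT, hj, rfl⟩
    rw [this]
    refine MeasurableSet.iUnion fun k => MeasurableSet.inter ?_ (MeasurableSet.const _)
    exact (measurableSet_eq_fun ((measurable_pi_apply j).comp (measurable_lbiState D X κ dt k).2.1)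
      measurable_const).compl

/-! Solutions of the Inverse Scale Space dynamics are encoded by finitely many affine pieces. -/

/-- `p` moves affinely from `q` at time `t` to `q'` at time `t'`, with constant `(θ, γ)`. -/
structure IsISSPiece (D : Matrix E V ℝ) (X : Matrix E J ℝ) (y : E → ℝ) (t : ℝ) (q : J → ℝ)
    (t' : ℝ) (q' : J → ℝ) (θ : V → ℝ) (γ : J → ℝ) : Prop where
  le : t ≤ t'
  normal : Dᵀ *ᵥ fitResidual D X y θ γ = 0
  step : q' = q + (t' - t) • (Xᵀ *ᵥ fitResidual D X y θ γ)
  left : IsL1Subgradient q γ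
  right : IsL1Subgradient q' γ

/-- `p` moves affinely from `q` at time `t` on, with constant `(θ, γ)`. -/
structure IsISSTail (D : Matrix E V ℝ) (X : Matrix E J ℝ) (y : E → ℝ) (t : ℝ) (q : J → ℝ)
    (θ : V → ℝ) (γ : J → ℝ) : Prop where
  normal : Dᵀ *ᵥ fitResidual D X y θ γ = 0
  subgrad : ∀ t', t ≤ t' → IsL1Subgradient (q + (t' - t) • (Xᵀ *ᵥ fitResidual D X y θ γ)) γ

/-- The triples `(y, t, q)` such that some concatenation of `n` pieces and a tail starts with the
value `q` at time `t` and visits `Q`, for the response `y`. -/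
def issHit (D : Matrix E V ℝ) (X : Matrix E J ℝ) :
    ℕ → Set (ℝ × (J → ℝ)) → Set ((E → ℝ) × ℝ × (J → ℝ))
  | 0, Q => {z | ∃ u : ℝ × (V → ℝ) × (J → ℝ), IsISSTail D X z.1 z.2.1 z.2.2 u.2.1 u.2.2 ∧
      z.2.1 ≤ u.1 ∧ (u.1, u.2.2) ∈ Q}
  | n + 1, Q =>
    {z | ∃ u : ℝ × ℝ × (J → ℝ) × (V → ℝ) × (J → ℝ),
      IsISSPiece D X z.1 z.2.1 z.2.2 u.2.1 u.2.2.1 u.2.2.2.1 u.2.2.2.2 ∧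
      (z.2.1 ≤ u.1 ∧ u.1 < u.2.1 ∧ (u.1, u.2.2.2.2) ∈ Q) ∧
      (z.1, u.2.1, u.2.2.1) ∈ issHit D X n Set.univ} ∪
    {z | ∃ u : ℝ × (J → ℝ) × (V → ℝ) × (J → ℝ),
      IsISSPiece D X z.1 z.2.1 z.2.2 u.1 u.2.1 u.2.2.1 u.2.2.2 ∧
      (z.1, u.1, u.2.1) ∈ issHit D X n Q}

lemma isClosed_isL1Subgradient : IsClosed {z : (J → ℝ) × (J → ℝ) | IsL1Subgradient z.1 z.2} := by
  simp only [IsL1Subgradient, Set.ofPred_forall]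
  refine isClosed_iInter fun x => isClosed_le ?_ continuous_const
  have := continuous_l1Norm (J := J)
  simp only [dotProduct]
  fun_prop

lemma isClosed_isISSPiece (D : Matrix E V ℝ) (X : Matrix E J ℝ) :
    IsClosed {z : ((E → ℝ) × ℝ × (J → ℝ)) × (ℝ × (J → ℝ) × (V → ℝ) × (J → ℝ)) |
      IsISSPiece D X z.1.1 z.1.2.1 z.1.2.2 z.2.1 z.2.2.1 z.2.2.2.1 z.2.2.2.2} := by
  have hr : Continuous fun z : ((E → ℝ) × ℝ × (J → ℝ)) × (ℝ × (J → ℝ) × (V → ℝ) × (J → ℝ)) =>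
      fitResidual D X z.1.1 z.2.2.2.1 z.2.2.2.2 :=
    (continuous_fitResidual D X).comp (by fun_prop : Continuous fun z : ((E → ℝ) × ℝ × (J → ℝ)) ×
      (ℝ × (J → ℝ) × (V → ℝ) × (J → ℝ)) => (z.1.1, z.2.2.2.1, z.2.2.2.2))
  have h1 : IsClosed {z : ((E → ℝ) × ℝ × (J → ℝ)) × (ℝ × (J → ℝ) × (V → ℝ) × (J → ℝ)) |
      z.1.2.1 ≤ z.2.1} := isClosed_le (by fun_prop) (by fun_prop)
  have h2 : IsClosed {z : ((E → ℝ) × ℝ × (J → ℝ)) × (ℝ × (J → ℝ) × (V → ℝ) × (J → ℝ)) |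
      Dᵀ *ᵥ fitResidual D X z.1.1 z.2.2.2.1 z.2.2.2.2 = 0} :=
    isClosed_eq (by fun_prop) (by fun_prop)
  have h3 : IsClosed {z : ((E → ℝ) × ℝ × (J → ℝ)) × (ℝ × (J → ℝ) × (V → ℝ) × (J → ℝ)) |
      z.2.2.1 = z.1.2.2 + (z.2.1 - z.1.2.1) •
        (Xᵀ *ᵥ fitResidual D X z.1.1 z.2.2.2.1 z.2.2.2.2)} :=
    isClosed_eq (by fun_prop) (by fun_prop)
  have h4 : IsClosed {z : ((E → ℝ) × ℝ × (J → ℝ)) × (ℝ × (J → ℝ) × (V → ℝ) × (J → ℝ)) |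
      IsL1Subgradient z.1.2.2 z.2.2.2.2} :=
    isClosed_isL1Subgradient.preimage (by fun_prop : Continuous fun z : ((E → ℝ) × ℝ × (J → ℝ)) ×
      (ℝ × (J → ℝ) × (V → ℝ) × (J → ℝ)) => (z.1.2.2, z.2.2.2.2))
  have h5 : IsClosed {z : ((E → ℝ) × ℝ × (J → ℝ)) × (ℝ × (J → ℝ) × (V → ℝ) × (J → ℝ)) |
      IsL1Subgradient z.2.2.1 z.2.2.2.2} :=
    isClosed_isL1Subgradient.preimage (by fun_prop : Continuous fun z : ((E → ℝ) × ℝ × (J → ℝ)) ×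
      (ℝ × (J → ℝ) × (V → ℝ) × (J → ℝ)) => (z.2.2.1, z.2.2.2.2))
  convert h1.inter (h2.inter (h3.inter (h4.inter h5))) using 1
  ext z
  exact ⟨fun ⟨a, b, c, d, e⟩ => ⟨a, b, c, d, e⟩, fun ⟨a, b, c, d, e⟩ => ⟨a, b, c, d, e⟩⟩

lemma isClosed_isISSTail (D : Matrix E V ℝ) (X : Matrix E J ℝ) :
    IsClosed {z : ((E → ℝ) × ℝ × (J → ℝ)) × (ℝ × (V → ℝ) × (J → ℝ)) |
      IsISSTail D X z.1.1 z.1.2.1 z.1.2.2 z.2.2.1 z.2.2.2} := by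
  have hr : Continuous fun z : ((E → ℝ) × ℝ × (J → ℝ)) × (ℝ × (V → ℝ) × (J → ℝ)) =>
      fitResidual D X z.1.1 z.2.2.1 z.2.2.2 :=
    (continuous_fitResidual D X).comp (by fun_prop : Continuous fun z : ((E → ℝ) × ℝ × (J → ℝ)) ×
      (ℝ × (V → ℝ) × (J → ℝ)) => (z.1.1, z.2.2.1, z.2.2.2))
  have h1 : IsClosed {z : ((E → ℝ) × ℝ × (J → ℝ)) × (ℝ × (V → ℝ) × (J → ℝ)) |
      Dᵀ *ᵥ fitResidual D X z.1.1 z.2.2.1 z.2.2.2 = 0} :=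
    isClosed_eq (by fun_prop) (by fun_prop)
  -- Indexing by the elapsed time `s = t' - t` makes the range of the intersection independent of
  -- the point `z`.
  have h2 : ∀ s : ℝ, 0 ≤ s → IsClosed {z : ((E → ℝ) × ℝ × (J → ℝ)) × (ℝ × (V → ℝ) × (J → ℝ)) |
      IsL1Subgradient (z.1.2.2 + s • (Xᵀ *ᵥ fitResidual D X z.1.1 z.2.2.1 z.2.2.2)) z.2.2.2} :=
    fun s _ => isClosed_isL1Subgradient.preimage (by fun_prop : Continuous fun z :
      ((E → ℝ) × ℝ × (J → ℝ)) × (ℝ × (V → ℝ) × (J → ℝ)) =>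
      (z.1.2.2 + s • (Xᵀ *ᵥ fitResidual D X z.1.1 z.2.2.1 z.2.2.2), z.2.2.2))
  convert h1.inter (isClosed_iInter fun s => isClosed_iInter fun hs => h2 s hs) using 1
  ext z
  simp only [Set.mem_inter_iff, Set.mem_iInter, Set.mem_ofPred_eq]
  constructor
  · rintro ⟨a, b⟩
    refine ⟨a, fun s hs => ?_⟩
    simpa using b (z.1.2.1 + s) (by linarith)
  · rintro ⟨a, b⟩
    exact ⟨a, fun t' ht' => b _ (by linarith)⟩

/-- `Q` varies in the induction: once the visit occurs in the first piece, the rest of the path only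
has to exist, which is the case `Q = univ`. -/
lemma isSigmaCompact_issHit (D : Matrix E V ℝ) (X : Matrix E J ℝ) (n : ℕ) :
    ∀ {Q : Set (ℝ × (J → ℝ))}, IsOpen Q → IsSigmaCompact (issHit D X n Q) := by
  induction n with
  | zero =>
    intro Q hQ
    have h1 : IsClosed {z : ((E → ℝ) × ℝ × (J → ℝ)) × (ℝ × (V → ℝ) × (J → ℝ)) |
      z.1.2.1 ≤ z.2.1} := isClosed_le (by fun_prop) (by fun_prop)
    have h2 : IsOpen {z : ((E → ℝ) × ℝ × (J → ℝ)) × (ℝ × (V → ℝ) × (J → ℝ)) |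
      (z.2.1, z.2.2.2) ∈ Q} := hQ.preimage (by fun_prop : Continuous fun z :
        ((E → ℝ) × ℝ × (J → ℝ)) × (ℝ × (V → ℝ) × (J → ℝ)) => (z.2.1, z.2.2.2))
    exact isSigmaCompact_exists (isSigmaCompact_inter
      (isSigmaCompact_of_isClosed (isClosed_isISSTail D X))
      (isSigmaCompact_inter (isSigmaCompact_of_isClosed h1) (isSigmaCompact_of_isOpen h2)))
  | succ n ih =>
    intro Q hQ
    refine isSigmaCompact_union ?_ ?_
    · have h0 := (isClosed_isISSPiece D X).preimage (by fun_prop : Continuous fun z :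
        ((E → ℝ) × ℝ × (J → ℝ)) × (ℝ × ℝ × (J → ℝ) × (V → ℝ) × (J → ℝ)) => (z.1, z.2.2))
      have h1 : IsClosed {z : ((E → ℝ) × ℝ × (J → ℝ)) × (ℝ × ℝ × (J → ℝ) × (V → ℝ) × (J → ℝ)) |
        z.1.2.1 ≤ z.2.1} := isClosed_le (by fun_prop) (by fun_prop)
      have h2 : IsOpen {z : ((E → ℝ) × ℝ × (J → ℝ)) × (ℝ × ℝ × (J → ℝ) × (V → ℝ) × (J → ℝ)) |
        z.2.1 < z.2.2.1} := isOpen_lt (by fun_prop) (by fun_prop)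
      have h3 : IsOpen {z : ((E → ℝ) × ℝ × (J → ℝ)) × (ℝ × ℝ × (J → ℝ) × (V → ℝ) × (J → ℝ)) |
        (z.2.1, z.2.2.2.2.2) ∈ Q} := hQ.preimage (by fun_prop : Continuous fun z :
        ((E → ℝ) × ℝ × (J → ℝ)) × (ℝ × ℝ × (J → ℝ) × (V → ℝ) × (J → ℝ)) => (z.2.1, z.2.2.2.2.2))
      have h4 := isSigmaCompact_preimage (by fun_prop : Continuous fun z :
        ((E → ℝ) × ℝ × (J → ℝ)) × (ℝ × ℝ × (J → ℝ) × (V → ℝ) × (J → ℝ)) =>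
          (z.1.1, z.2.2.1, z.2.2.2.1)) (ih isOpen_univ)
      exact isSigmaCompact_exists (isSigmaCompact_inter (isSigmaCompact_of_isClosed h0)
        (isSigmaCompact_inter (isSigmaCompact_inter (isSigmaCompact_of_isClosed h1)
          (isSigmaCompact_inter (isSigmaCompact_of_isOpen h2) (isSigmaCompact_of_isOpen h3))) h4))
    · have h4 := isSigmaCompact_preimage (by fun_prop : Continuous fun z :
        ((E → ℝ) × ℝ × (J → ℝ)) × (ℝ × (J → ℝ) × (V → ℝ) × (J → ℝ)) =>
          (z.1.1, z.2.1, z.2.2.1)) (ih hQ)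
      exact isSigmaCompact_exists (isSigmaCompact_inter
        (isSigmaCompact_of_isClosed (isClosed_isISSPiece D X)) h4)

end Paths

/-! ### ISS paths are exactly concatenations of finitely many affine pieces. -/

section ISS

variable {E V J : Type*} [Fintype E] [Fintype V] [Fintype J]

/-- The Inverse Scale Space dynamics started with the value `q` at time `t₀`. -/
structure IsISSPathFrom (D : Matrix E V ℝ) (X : Matrix E J ℝ) (Y : E → ℝ) (t₀ : ℝ) (q : J → ℝ)
    (p : ℝ → J → ℝ) (θ : ℝ → V → ℝ) (γ : ℝ → J → ℝ) : Prop where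
  init : p t₀ = q
  cont : ContinuousOn p (Set.Ici t₀)
  flow : ∀ t, t₀ ≤ t → HasDerivWithinAt p (Xᵀ *ᵥ fitResidual D X Y (θ t) (γ t)) (Set.Ici t) t
  normal : ∀ t, t₀ ≤ t → Dᵀ *ᵥ fitResidual D X Y (θ t) (γ t) = 0
  subgrad : ∀ t, t₀ ≤ t → IsL1Subgradient (p t) (γ t)
  steps : ∃ F : Finset ℝ, ∀ a b, t₀ ≤ a → a ≤ b → (∀ x ∈ F, ¬ (a < x ∧ x ≤ b)) → γ a = γ b

variable {D : Matrix E V ℝ} {X : Matrix E J ℝ} {Y : E → ℝ} {p : ℝ → J → ℝ} {θ : ℝ → V → ℝ}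
  {γ : ℝ → J → ℝ} {t₀ : ℝ} {q : J → ℝ}

lemma isISSPath_iff_from : IsISSPath D X Y p θ γ ↔ IsISSPathFrom D X Y 0 0 p θ γ :=
  ⟨fun ⟨a, b, c, d, e, f⟩ => ⟨a, b, c, d, e, f⟩, fun ⟨a, b, c, d, e, f⟩ => ⟨a, b, c, d, e, f⟩⟩

lemma IsISSPathFrom.restrict (h : IsISSPathFrom D X Y t₀ q p θ γ) {t : ℝ} (ht : t₀ ≤ t) :
    IsISSPathFrom D X Y t (p t) p θ γ where
  init := rfl
  cont := h.cont.mono (Set.Ici_subset_Ici.2 ht)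
  flow := fun s hs => h.flow s (ht.trans hs)
  normal := fun s hs => h.normal s (ht.trans hs)
  subgrad := fun s hs => h.subgrad s (ht.trans hs)
  steps := by
    obtain ⟨F, hF⟩ := h.steps
    exact ⟨F, fun a b ha => hF a b (ht.trans ha)⟩

/-- The difference lies in the range of `D` and is orthogonal to it. Hence `γ` alone determines the
drift of `p`, although `θ` may be non-unique and irregular in time. -/
lemma fitResidual_eq_of_normal {θ₁ θ₂ : V → ℝ} {γ : J → ℝ}
    (h₁ : Dᵀ *ᵥ fitResidual D X Y θ₁ γ = 0) (h₂ : Dᵀ *ᵥ fitResidual D X Y θ₂ γ = 0) :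
    fitResidual D X Y θ₁ γ = fitResidual D X Y θ₂ γ := by
  have hsub : fitResidual D X Y θ₁ γ - fitResidual D X Y θ₂ γ = D *ᵥ (θ₂ - θ₁) := by
    rw [fitResidual, fitResidual, mulVec_sub]; abel
  have h0 : Dᵀ *ᵥ (D *ᵥ (θ₂ - θ₁)) = 0 := by rw [← hsub, mulVec_sub, h₁, h₂, sub_zero]
  have h1 : (D *ᵥ (θ₂ - θ₁)) ⬝ᵥ (D *ᵥ (θ₂ - θ₁)) = 0 := by
    rw [dotProduct_comm, dotProduct_mulVec, ← mulVec_transpose, h0, zero_dotProduct]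
  rw [← sub_eq_zero, hsub]
  exact dotProduct_self_eq_zero.1 h1

lemma IsISSPathFrom.eq_affine (h : IsISSPathFrom D X Y t₀ q p θ γ) {b : ℝ}
    (hconst : ∀ s, t₀ ≤ s → s < b → γ t₀ = γ s) {s : ℝ} (hs : s ∈ Set.Icc t₀ b) :
    p s = q + (s - t₀) • (Xᵀ *ᵥ fitResidual D X Y (θ t₀) (γ t₀)) := by
  set v := Xᵀ *ᵥ fitResidual D X Y (θ t₀) (γ t₀) with hv
  have hderiv : ∀ x ∈ Set.Ico t₀ b,
      HasDerivWithinAt (fun s => p s - (s - t₀) • v) 0 (Set.Ici x) x := by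
    intro x hx
    have h1 := h.flow x hx.1
    have hn := h.normal x hx.1
    rw [← hconst x hx.1 hx.2] at h1 hn
    rw [fitResidual_eq_of_normal hn (h.normal t₀ le_rfl), ← hv] at h1
    have h2 : HasDerivWithinAt (fun s : ℝ => (s - t₀) • v) ((1 : ℝ) • v) (Set.Ici x) x :=
      ((hasDerivWithinAt_id x _).sub_const t₀).smul_const v
    have h3 := h1.sub h2
    rw [one_smul, sub_self] at h3
    exact h3
  have hcont : ContinuousOn (fun s => p s - (s - t₀) • v) (Set.Icc t₀ b) :=
    (h.cont.mono Set.Icc_subset_Ici_self).sub (by fun_prop)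
  have := constant_of_has_deriv_right_zero hcont hderiv s hs
  simp only [sub_self, zero_smul, sub_zero, h.init] at this
  rw [← this, sub_add_cancel]

lemma isClosed_setOf_isL1Subgradient (γ : J → ℝ) : IsClosed {p | IsL1Subgradient p γ} :=
  isClosed_isL1Subgradient.preimage (by fun_prop : Continuous fun p : J → ℝ => (p, γ))

lemma IsISSPathFrom.isISSPiece (h : IsISSPathFrom D X Y t₀ q p θ γ) {b : ℝ} (hb : t₀ < b)
    (hconst : ∀ s, t₀ ≤ s → s < b → γ t₀ = γ s) :
    IsISSPiece D X Y t₀ q b (p b) (θ t₀) (γ t₀) where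
  le := hb.le
  normal := h.normal t₀ le_rfl
  step := h.eq_affine hconst ⟨hb.le, le_rfl⟩
  left := h.init ▸ h.subgrad t₀ le_rfl
  right := by
    -- `γ` may jump at `b`, so the condition for the old `γ t₀` is obtained as a limit from the
    -- left.
    have hmem : b ∈ closure (Set.Ico t₀ b) := by
      rw [closure_Ico hb.ne]; exact ⟨hb.le, le_rfl⟩
    have hmaps : Set.MapsTo p (Set.Ico t₀ b) {p | IsL1Subgradient p (γ t₀)} := fun s hs => by
      have := h.subgrad s hs.1
      rwa [← hconst s hs.1 hs.2] at this
    have hc : ContinuousWithinAt p (Set.Ico t₀ b) b :=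
      (h.cont b hb.le).mono fun s hs => hs.1
    have := hc.mem_closure hmem hmaps
    rwa [(isClosed_setOf_isL1Subgradient _).closure_eq] at this

/-- Induction on the number of possible jump times after `t₀`: up to the first one, `b`, the path is
one affine piece, and the path restarted at `b` has one fewer. -/
lemma IsISSPathFrom.exists_mem_issHit (n : ℕ) : ∀ {t₀ : ℝ} {q : J → ℝ} (F : Finset ℝ),
    (F.filter fun x => t₀ < x).card = n → IsISSPathFrom D X Y t₀ q p θ γ →
    (∀ a b, t₀ ≤ a → a ≤ b → (∀ x ∈ F, ¬ (a < x ∧ x ≤ b)) → γ a = γ b) →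
    ∀ {Q : Set (ℝ × (J → ℝ))} {x : ℝ}, t₀ ≤ x → (x, γ x) ∈ Q → (Y, t₀, q) ∈ issHit D X n Q := by
  induction n with
  | zero =>
    intro t₀ q F hF h hsteps Q x hx hQ
    have hconst : ∀ s, t₀ ≤ s → γ t₀ = γ s := fun s hs => by
      refine hsteps _ _ le_rfl hs fun y hy hlt => ?_
      rw [Finset.card_eq_zero, Finset.filter_eq_empty_iff] at hF
      exact hF hy hlt.1
    refine ⟨(x, θ t₀, γ t₀), ⟨h.normal _ le_rfl, fun t' ht' => ?_⟩, hx, ?_⟩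
    · have h1 := h.subgrad t' ht'
      rwa [h.eq_affine (b := t') (fun s hs _ => hconst s hs) ⟨ht', le_rfl⟩, ← hconst t' ht'] at h1
    · simpa only [hconst x hx] using hQ
  | succ n ih =>
    intro t₀ q F hF h hsteps Q x hx hQ
    have hne : (F.filter fun x => t₀ < x).Nonempty := by
      rw [← Finset.card_pos, hF]; omega
    set b := (F.filter fun x => t₀ < x).min' hne with hb
    have hbmem := (F.filter fun x => t₀ < x).min'_mem hne
    rw [← hb] at hbmem
    have hb0 : t₀ < b := (Finset.mem_filter.1 hbmem).2
    have hmin : ∀ y ∈ F, t₀ < y → b ≤ y := fun y hy hty =>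
      Finset.min'_le _ _ (Finset.mem_filter.2 ⟨hy, hty⟩)
    have hconst : ∀ s, t₀ ≤ s → s < b → γ t₀ = γ s := fun s hs hsb =>
      hsteps _ _ le_rfl hs fun y hy hlt => absurd (hmin y hy hlt.1) (not_le.2 (hlt.2.trans_lt hsb))
    have hcard : (F.filter fun x => b < x).card = n := by
      have : (F.filter fun x => b < x) = (F.filter fun x => t₀ < x).erase b := by
        ext y
        simp only [Finset.mem_filter, Finset.mem_erase]
        constructor
        · rintro ⟨hy, hby⟩
          exact ⟨hby.ne', hy, hb0.trans hby⟩
        · rintro ⟨hyb, hy, hty⟩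
          exact ⟨hy, lt_of_le_of_ne (hmin y hy hty) (Ne.symm hyb)⟩
      rw [this, Finset.card_erase_of_mem hbmem, hF, Nat.add_sub_cancel]
    have hrest := h.restrict hb0.le
    have hsteps' : ∀ a c, b ≤ a → a ≤ c → (∀ x ∈ F, ¬ (a < x ∧ x ≤ c)) → γ a = γ c :=
      fun a c ha => hsteps a c (hb0.le.trans ha)
    have hpiece := h.isISSPiece hb0 hconst
    rcases lt_or_ge x b with hxb | hxb
    · refine Or.inl ⟨(x, b, p b, θ t₀, γ t₀), hpiece, ⟨hx, hxb, ?_⟩,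
        ih F hcard hrest hsteps' le_rfl (Set.mem_univ _)⟩
      simpa only [hconst x hx hxb] using hQ
    · exact Or.inr ⟨(b, p b, θ t₀, γ t₀), hpiece, ih F hcard hrest hsteps' hxb hQ⟩

/-- The subgradient inequalities are affine in `p`, so they hold on a segment once they hold at its
ends. This is why a piece records only its endpoints. -/
lemma IsL1Subgradient.segment {q v γ : J → ℝ} {l c : ℝ} (h₀ : IsL1Subgradient q γ)
    (h₁ : IsL1Subgradient (q + l • v) γ) (hc : 0 ≤ c) (hcl : c ≤ l) :
    IsL1Subgradient (q + c • v) γ := by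
  intro x
  have h0 := h₀ x
  have h1 := h₁ x
  rw [add_dotProduct, smul_dotProduct, smul_eq_mul] at h1 ⊢
  rcases le_total 0 (v ⬝ᵥ (x - γ)) with h | h
  · nlinarith
  · nlinarith

lemma IsISSTail.isISSPathFrom {θ₀ : V → ℝ} {γ₀ : J → ℝ} (h : IsISSTail D X Y t₀ q θ₀ γ₀) :
    IsISSPathFrom D X Y t₀ q (fun s => q + (s - t₀) • (Xᵀ *ᵥ fitResidual D X Y θ₀ γ₀))
      (fun _ => θ₀) (fun _ => γ₀) where
  init := by simp
  cont := by fun_prop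
  flow := fun t _ => by
    simpa using (((hasDerivWithinAt_id t (Set.Ici t)).sub_const t₀).smul_const
      (Xᵀ *ᵥ fitResidual D X Y θ₀ γ₀)).const_add q
  normal := fun _ _ => h.normal
  subgrad := fun t ht => h.subgrad t ht
  steps := ⟨∅, fun _ _ _ _ _ => rfl⟩

-- The `min`/`max` formula equals the affine piece before `t'` and `p` afterwards; as a single
-- expression it is visibly continuous across `t'`.
open Classical in
lemma IsISSPiece.glue {t' : ℝ} {q' : J → ℝ} {θ₀ : V → ℝ} {γ₀ : J → ℝ}
    (h : IsISSPiece D X Y t₀ q t' q' θ₀ γ₀) (hp : IsISSPathFrom D X Y t' q' p θ γ) :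
    IsISSPathFrom D X Y t₀ q
      (fun s => q + (min s t' - t₀) • (Xᵀ *ᵥ fitResidual D X Y θ₀ γ₀) + (p (max s t') - q'))
      (fun s => if s < t' then θ₀ else θ s) (fun s => if s < t' then γ₀ else γ s) := by
  set v := Xᵀ *ᵥ fitResidual D X Y θ₀ γ₀ with hv
  have hleft : ∀ s, s ≤ t' → q + (min s t' - t₀) • v + (p (max s t') - q') = q + (s - t₀) • v := by
    intro s hs
    rw [min_eq_left hs, max_eq_right hs, hp.init, sub_self, add_zero]
  have hright : ∀ s, t' ≤ s → q + (min s t' - t₀) • v + (p (max s t') - q') = p s := by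
    intro s hs
    rw [min_eq_right hs, max_eq_left hs, ← h.step, add_sub_cancel]
  refine ⟨?_, ?_, ?_, ?_, ?_, ?_⟩
  · simpa using hleft t₀ h.le
  · have : ContinuousOn (fun s => p (max s t')) (Set.Ici t₀) :=
      hp.cont.comp (by fun_prop) fun s _ => le_max_right s t'
    exact ContinuousOn.add (by fun_prop) (this.sub continuousOn_const)
  · intro s hs
    rcases lt_or_ge s t' with hst | hst
    · simp only [if_pos hst]
      have h1 : HasDerivWithinAt (fun s => q + (s - t₀) • v) v (Set.Ici s) s := by
        simpa using (((hasDerivWithinAt_id s (Set.Ici s)).sub_const t₀).smul_const v).const_add q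
      refine h1.congr_of_eventuallyEq ?_ (hleft s hst.le)
      filter_upwards [mem_nhdsWithin_of_mem_nhds (Iio_mem_nhds hst)] with x hx
      exact hleft x (le_of_lt hx)
    · simp only [if_neg (not_lt.2 hst)]
      exact (hp.flow s hst).congr (fun x hx => hright x (hst.trans hx)) (hright s hst)
  · intro s hs
    rcases lt_or_ge s t' with hst | hst
    · simp only [if_pos hst]
      exact h.normal
    · simp only [if_neg (not_lt.2 hst)]
      exact hp.normal s hst
  · intro s hs
    rcases lt_or_ge s t' with hst | hst
    · simp only [if_pos hst]
      rw [hleft s hst.le]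
      exact h.left.segment (h.step ▸ h.right) (sub_nonneg.2 hs) (by linarith)
    · simp only [if_neg (not_lt.2 hst)]
      rw [hright s hst]
      exact hp.subgrad s hst
  · obtain ⟨F, hF⟩ := hp.steps
    refine ⟨insert t' F, fun a b ha hab hx => ?_⟩
    rcases lt_or_ge b t' with hb | hb
    · simp [hb, hab.trans_lt hb]
    · rcases lt_or_ge a t' with hat | hat
      · exact absurd ⟨hat, hb⟩ (hx t' (Finset.mem_insert_self _ _))
      · simp only [if_neg (not_lt.2 hb), if_neg (not_lt.2 hat)]
        exact hF a b hat hab fun x hxF => hx x (Finset.mem_insert_of_mem hxF)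

lemma exists_path_of_mem_issHit (n : ℕ) : ∀ {t₀ : ℝ} {q : J → ℝ} {Q : Set (ℝ × (J → ℝ))},
    (Y, t₀, q) ∈ issHit D X n Q → ∃ p θ γ, IsISSPathFrom D X Y t₀ q p θ γ ∧
      ∃ x, t₀ ≤ x ∧ (x, γ x) ∈ Q := by
  classical
  induction n with
  | zero =>
    rintro t₀ q Q ⟨⟨x, θ₀, γ₀⟩, h, hx, hQ⟩
    exact ⟨_, _, _, h.isISSPathFrom, x, hx, hQ⟩
  | succ n ih =>
    rintro t₀ q Q (⟨⟨x, t', q', θ₀, γ₀⟩, h, ⟨hx, hxt, hQ⟩, hn⟩ | ⟨⟨t', q', θ₀, γ₀⟩, h, hn⟩)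
    -- The visit is strictly before `t'`, because the glued path already takes the next value of `γ`
    -- at `t'`.
    · obtain ⟨p, θ, γ, hp, -⟩ := ih hn
      exact ⟨_, _, _, h.glue hp, x, hx, by simpa only [if_pos hxt] using hQ⟩
    · obtain ⟨p, θ, γ, hp, x, hx, hQ⟩ := ih hn
      exact ⟨_, _, _, h.glue hp, x, h.le.trans hx, by simpa only [if_neg (not_lt.2 hx)] using hQ⟩

lemma exists_issPath_iff {Q : Set (ℝ × (J → ℝ))} :
    (∃ p θ γ, IsISSPath D X Y p θ γ ∧ ∃ x, 0 ≤ x ∧ (x, γ x) ∈ Q) ↔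
      ∃ n, (Y, 0, 0) ∈ issHit D X n Q := by
  constructor
  · rintro ⟨p, θ, γ, h, x, hx, hQ⟩
    obtain ⟨F, hF⟩ := h.steps
    exact ⟨_, IsISSPathFrom.exists_mem_issHit _ F rfl (isISSPath_iff_from.1 h) hF hx hQ⟩
  · rintro ⟨n, hn⟩
    obtain ⟨p, θ, γ, h, hx⟩ := exists_path_of_mem_issHit n hn
    exact ⟨p, θ, γ, isISSPath_iff_from.2 h, hx⟩

lemma measurable_issEntry (D : Matrix E V ℝ) (X : Matrix E J ℝ) (j : J) :
    Measurable fun y => issEntry D X y j := by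
  refine measurable_sSup_setOf ?_ fun a => ?_
  · rintro y r ⟨t, ht, -, rfl⟩
    positivity
  -- For `t > 0`, `a < 1 / t` is written as `a * t < 1`, an open condition without division.
  · set Q : Set (ℝ × (J → ℝ)) := {z | 0 < z.1 ∧ a * z.1 < 1 ∧ z.2 j ≠ 0}
    have hQ : IsOpen Q := by
      have h1 : IsOpen {z : ℝ × (J → ℝ) | 0 < z.1} := isOpen_lt (by fun_prop) (by fun_prop)
      have h2 : IsOpen {z : ℝ × (J → ℝ) | a * z.1 < 1} := isOpen_lt (by fun_prop) (by fun_prop)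
      have h3 : IsOpen {z : ℝ × (J → ℝ) | z.2 j ≠ 0} := isOpen_ne_fun (by fun_prop) (by fun_prop)
      exact h1.inter (h2.inter h3)
    have : {y | ∃ r, a < r ∧ ∃ t, 0 < t ∧ (∃ p θ γ, IsISSPath D X y p θ γ ∧ γ t j ≠ 0) ∧
        r = 1 / t} = ⋃ n, (fun y : E → ℝ => (y, (0 : ℝ), (0 : J → ℝ))) ⁻¹' issHit D X n Q := by
      ext y
      simp only [Set.mem_iUnion, Set.mem_preimage]
      rw [← exists_issPath_iff]
      constructor
      · rintro ⟨r, har, t, ht, ⟨p, θ, γ, h, hj⟩, rfl⟩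
        exact ⟨p, θ, γ, h, t, ht.le, ht, (lt_div_iff₀ ht).1 har, hj⟩
      · rintro ⟨p, θ, γ, h, t, -, ht, hat, hj⟩
        exact ⟨1 / t, (lt_div_iff₀ ht).2 hat, t, ht, ⟨p, θ, γ, h, hj⟩, rfl⟩
    rw [this]
    exact MeasurableSet.iUnion fun n => measurableSet_of_isSigmaCompact
      (isSigmaCompact_preimage (by fun_prop) (isSigmaCompact_issHit D X n hQ))

end ISS

/-! ### Measurability of the knockoff statistics. -/

section Statistic

variable {E V J U : Type*} [Fintype E] [Fintype V] [Fintype J] [Fintype U] [DecidableEq V]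

lemma PathMethod.measurable_entry (m : PathMethod) (D : Matrix E V ℝ) (X : Matrix E J ℝ) (j : J) :
    Measurable fun y => m.entry D X y j := by
  cases m with
  | lasso => exact measurable_lassoEntry D X j
  | iss => exact measurable_issEntry D X j
  | lbi κ dt _ hdt T => exact measurable_lbiEntry D X hdt T j

lemma measurable_knockoffStat (m : PathMethod) (D : Matrix E V ℝ) (A B : Matrix E U ℝ) :
    Measurable fun y => knockoffStat m D A B y := by
  refine measurable_pi_lambda _ fun j => ?_
  have h1 := m.measurable_entry D (fromCols A B) (Sum.inl j)
  have h2 := m.measurable_entry D (fromCols A B) (Sum.inr j)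
  exact (h1.max h2).mul (measurable_sign.comp (h1.sub h2))

end Statistic

/-! ### Rotation invariance of the noise. -/

section Gaussian

variable {E : Type*} [Fintype E]

lemma charFun_map_toLp_pi_gaussianReal (v : ℝ≥0) (t : EuclideanSpace ℝ E) :
    charFun ((Measure.pi fun _ : E => gaussianReal 0 v).map (WithLp.toLp 2)) t =
      Complex.exp (-(v * ‖t‖ ^ 2) / 2) := by
  simp_rw [charFun_pi, charFun_gaussianReal, ← Complex.exp_sum, ← Complex.ofReal_pow,
    EuclideanSpace.real_norm_sq_eq]
  simp [Finset.sum_div, neg_div, Finset.mul_sum]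

/-- Independent centred Gaussian variables with a common variance have a rotation invariant law. -/
lemma map_mulVec_pi_gaussianReal [DecidableEq E] (v : ℝ≥0) {R : Matrix E E ℝ}
    (hR : R * Rᵀ = 1) :
    (Measure.pi fun _ : E => gaussianReal 0 v).map (fun x => R *ᵥ x) =
      Measure.pi fun _ : E => gaussianReal 0 v := by
  set μ := Measure.pi fun _ : E => gaussianReal 0 v
  have hmeas : Measurable fun x : E → ℝ => R *ᵥ x := measurable_mulVec R
  have htoLp : Measurable (WithLp.toLp 2 : (E → ℝ) → EuclideanSpace ℝ E) := by fun_prop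
  have hofLp : Measurable (WithLp.ofLp : EuclideanSpace ℝ E → E → ℝ) := by fun_prop
  -- Characteristic functions need an inner product, hence the detour through `EuclideanSpace`. The
  -- transform depends only on `‖t‖`, which `Rᵀ` preserves.
  have key : (μ.map fun x => R *ᵥ x).map (WithLp.toLp 2) =
      (μ.map (WithLp.toLp 2) : Measure (EuclideanSpace ℝ E)) := by
    apply Measure.ext_of_charFun (E := EuclideanSpace ℝ E)
    ext t
    have h1 : charFun ((μ.map fun x => R *ᵥ x).map (WithLp.toLp 2)) t =
        charFun (μ.map (WithLp.toLp 2)) (WithLp.toLp 2 (Rᵀ *ᵥ WithLp.ofLp t)) := by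
      rw [charFun_apply, charFun_apply, integral_map (by fun_prop) (by fun_prop),
        integral_map hmeas.aemeasurable (by fun_prop), integral_map (by fun_prop) (by fun_prop)]
      refine integral_congr_ae (Filter.Eventually.of_forall fun x => ?_)
      have : inner ℝ (WithLp.toLp 2 (R *ᵥ x)) t =
          inner ℝ (WithLp.toLp 2 x) (WithLp.toLp 2 (Rᵀ *ᵥ WithLp.ofLp t)) := by
        simp only [EuclideanSpace.inner_eq_star_dotProduct, star_trivial]
        rw [mulVec_transpose, ← dotProduct_mulVec]
      simp only [this]
    have h2 : ‖(WithLp.toLp 2 (Rᵀ *ᵥ WithLp.ofLp t) : EuclideanSpace ℝ E)‖ ^ 2 = ‖t‖ ^ 2 := by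
      rw [← real_inner_self_eq_norm_sq, ← real_inner_self_eq_norm_sq]
      simp only [EuclideanSpace.inner_eq_star_dotProduct, star_trivial]
      rw [dotProduct_mulVec, vecMul_mulVec, transpose_transpose, hR, vecMul_one]
    rw [h1, charFun_map_toLp_pi_gaussianReal, charFun_map_toLp_pi_gaussianReal]
    norm_cast
    rw [h2]
  have := congrArg (Measure.map WithLp.ofLp) key
  rw [Measure.map_map hofLp htoLp, Measure.map_map hofLp htoLp] at this
  simpa [Function.comp_def] using this

end Gaussian

end CrowdKnockoff

/-! ### Assembly: the law `ν` of the statistics is invariant under null sign flips. -/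

open CrowdKnockoff in
theorem theorem1 {E U V Ω : Type*} [Fintype E] [Fintype U] [Fintype V]
    [DecidableEq U] [DecidableEq V] [MeasurableSpace Ω] (P : Measure Ω) [IsProbabilityMeasure P]
    (annot : E → U) (left right : E → V)
    (hcard : 2 * Fintype.card U + Fintype.card V ≤ Fintype.card E)
    (θ : V → ℝ) (γ : U → ℝ) (σ : ℝ≥0) (ε : E → Ω → ℝ)
    (hlaw : ∀ e, HasLaw (ε e) (gaussianReal 0 (σ ^ 2)) P) (hindep : iIndepFun ε P)
    (B : Matrix E U ℝ) (s : U → ℝ)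
    (hB : CrowdKnockoff.IsKnockoff (CrowdKnockoff.gradientMatrix left right)
      (CrowdKnockoff.annotatorMatrix annot) B s)
    (m : CrowdKnockoff.PathMethod) (q : ℝ) (hq : q ∈ Set.Icc (0 : ℝ) 1) :
    let D : Matrix E V ℝ := CrowdKnockoff.gradientMatrix left right
    let A : Matrix E U ℝ := CrowdKnockoff.annotatorMatrix annot
    let Y : Ω → E → ℝ := fun ω => D *ᵥ θ + A *ᵥ γ + fun e => ε e ω
    let S : ℝ → Ω → Finset U := fun c ω =>
      CrowdKnockoff.selected c q (CrowdKnockoff.knockoffStat m D A B (Y ω))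
    (AEMeasurable (fun ω => CrowdKnockoff.modifiedFDP q γ (S 0 ω)) P ∧
      ∫⁻ ω, CrowdKnockoff.modifiedFDP q γ (S 0 ω) ∂P ≤ ENNReal.ofReal q) ∧
    (AEMeasurable (fun ω => CrowdKnockoff.FDP γ (S 1 ω)) P ∧
      ∫⁻ ω, CrowdKnockoff.FDP γ (S 1 ω) ∂P ≤ ENNReal.ofReal q) := by
  classical
  intro D A Y S
  set f : (E → ℝ) → U → ℝ := fun x => knockoffStat m D A B (D *ᵥ θ + A *ᵥ γ + x) with hf
  have hfm : Measurable f :=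
    (measurable_knockoffStat m D A B).comp (measurable_const.add measurable_id)
  have hε : AEMeasurable (fun ω e => ε e ω) P :=
    aemeasurable_pi_lambda _ fun e => (hlaw e).aemeasurable
  have hWm : AEMeasurable (fun ω => f fun e => ε e ω) P := hfm.comp_aemeasurable hε
  have hεlaw : P.map (fun ω e => ε e ω) = Measure.pi fun _ : E => gaussianReal 0 (σ ^ 2) := by
    rw [(iIndepFun_iff_map_fun_eq_pi_map fun e => (hlaw e).aemeasurable).1 hindep]
    simp_rw [fun e => (hlaw e).map_eq]
  set ν := P.map fun ω => f fun e => ε e ω with hν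
  have : IsProbabilityMeasure ν := Measure.isProbabilityMeasure_map hWm
  have hν' : ν = (Measure.pi fun _ : E => gaussianReal 0 (σ ^ 2)).map f := by
    rw [← hεlaw, AEMeasurable.map_map_of_aemeasurable hfm.aemeasurable hε]
    rfl
  have hflip : ∀ j, γ j = 0 → ν.map (flipSign j) = ν := by
    intro j hj
    have hsym := hB.isSymmetry j
    -- The reflection fixes the mean, so reflecting the response is the same as reflecting the noise
    -- alone.
    have hcomp : flipSign j ∘ f = f ∘ fun x => swapReflection A B j *ᵥ x := by
      funext x
      simp only [hf, Function.comp]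
      rw [← hB.knockoffStat_swapReflection, mulVec_add, hB.swapReflection_mulVec j hj]
    conv_rhs => rw [hν', ← map_mulVec_pi_gaussianReal (σ ^ 2) (R := swapReflection A B j)
      (by rw [hsym.symm, hsym.mul_self])]
    rw [hν', Measure.map_map (measurable_flipSign j) hfm, hcomp,
      Measure.map_map hfm (measurable_mulVec _)]
  have hmod := measurable_comp_selected 0 q (modifiedFDP q γ)
  have hfdp := measurable_comp_selected 1 q (FDP γ)
  refine ⟨⟨hmod.comp_aemeasurable hWm, ?_⟩, ⟨hfdp.comp_aemeasurable hWm, ?_⟩⟩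
  · refine le_trans (le_of_eq ?_) (lintegral_modifiedFDP_le hq.1 γ hflip)
    rw [hν, lintegral_map' hmod.aemeasurable hWm]
  · refine le_trans (le_of_eq ?_) (lintegral_FDP_le hq.1 γ hflip)
    rw [hν, lintegral_map' hfdp.aemeasurable hWm]
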